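/- Let $p\ge 1$, $q\ge 1$ and let $C=(C^1,\dots,C^p)\in\mathfrak{so}(q)^p$ have linearly independent entries. Let $\mathfrak N_C=\mathbb R^q\oplus\mathbb R^p$ be the 2-step nilpotent Lie algebra with $[e_i,e_j]=\sum_k C^k_{ij}e_{q+k}$ for $i,j\le q$ and all other brackets of basis vectors zero, let $N_C$ be its simply connected Lie group, and let $\mathfrak z=0\oplus\mathbb R^p=[\mathfrak N_C,\mathfrak N_C]$, $Z=\exp\mathfrak z$. A left-invariant metric on $N_C$ (that is, an inner product on $\mathfrak N_C$) induces a metric $g$ on the base $N_C/Z\cong\mathbb R^q$ of the principal bundle $N_C\to N_C/Z$, a metric $k$ on $\mathfrak z$, and the left-invariant connection form with kernel $\mathcal H=\mathfrak z^\perp$, whose curvature is regarded as a $\mathfrak z$-valued 2-form $\tilde\Omega$ on $N_C/Z$. Put $\tilde\Omega^2_{ij}=g^{kl}k_{\alpha\beta}\tilde\Omega^\alpha_{ki}\tilde\Omega^\beta_{lj}$. The left-invariant metric is a Ricci Yang–Mills soliton if $$\tilde\Omega^2-2\,\mathrm{Rc}(g)=\lambda g+\mathcal L_Xg,\qquad \Delta_d\tilde\Omega=\mathcal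 L_X\tilde\Omega$$ for some $\lambda\in\mathbb R$ and some smooth vector field $X$ on $N_C/Z$, where $\Delta_d=-(d\delta+\delta d)$; it is a trivial Ricci Yang–Mills soliton if these equations hold with $X=0$. Let $SL_q\mathbb R$ act on $\mathfrak{so}(q)^p$ by $g\cdot C=(gC^1g^t,\dots,gC^pg^t)$. (1) If the orbit $SL_q\mathbb R\cdot C$ is closed in $\mathfrak{so}(q)^p$, then $N_C$ admits a left-invariant metric that is a trivial Ricci Yang–Mills soliton. (2) Let any left-invariant metric on $N_C$ be given. There are orthonormal bases $X_1,\dots,X_q,Z_1,\dots,Z_p$ of $\mathfrak N_C$ with $Z_k\in\mathfrak z$; such a basis has structure matrices $D=(D^1,\dots,D^p)\in\mathfrak{so}(q)^p$, defined by $[X_i,X_j]=\sum_kD^k_{ij}Z_k$. For the tuple $D$ of any such basis, the metric is a trivial Ricci Yang–Mills soliton if and only if $D$ is a minimal point of the $SL_q\mathbb R$-action, that is, $m(D)D^k+D^km(D)^t=0$ for all $k$, where $m(D)=m_1(D)-\tfrac1q\operatorname{tr}(m_1(D))\,\mathrm{Id}$ and $m_1(D)=-2\sum_k(D^k)^2$.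 (These are the metrics that are called geodesically flow-invariant.) (3) If a left-invariant metric on $N_C$ is a trivial Ricci Yang–Mills soliton, then its Ricci tensor is invariant under the geodesic flow: $\mathrm{Ric}(\gamma',\gamma')$ is constant along every geodesic $\gamma$ of $N_C$. Conversely, if the Ricci tensor of a left-invariant metric is invariant under the geodesic flow and its structure matrices $D^1,\dots,D^p$ have no common nontrivial proper invariant subspace of $\mathbb R^q$, then the metric is a trivial Ricci Yang–Mills soliton. -/

import Mathlib

open Matrix
open scoped ContDiff

noncomputable section

namespace RYM

/-! ### Tuples of skew-symmetric matrices and the action of `SL_q` -/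

/-- The vector space `so(q)^p`, with its usual topology. -/
abbrev SkewTuple (q p : ℕ) : Type := Fin p → LieAlgebra.Orthogonal.so (Fin q) ℝ

/-- The action `g · (C¹, …, Cᵖ) = (g C¹ gᵗ, …, g Cᵖ gᵗ)` of `SL_q(ℝ)` on `so(q)^p`. -/
def slAct {q p : ℕ} (g : Matrix.SpecialLinearGroup (Fin q) ℝ) (C : SkewTuple q p) :
    SkewTuple q p := fun k =>
  ⟨(g : Matrix (Fin q) (Fin q) ℝ) * (C k).1 * (g : Matrix (Fin q) (Fin q) ℝ)ᵀ, by
    have h := (LieAlgebra.Orthogonal.mem_so (Fin q) ℝ (C k).1).1 (C k).2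
    rw [LieAlgebra.Orthogonal.mem_so]
    simp [Matrix.transpose_mul, h, Matrix.mul_assoc]⟩

/-- The orbit `SL_q(ℝ) · C`, a subset of `so(q)^p`. -/
def slOrbit {q p : ℕ} (C : SkewTuple q p) : Set (SkewTuple q p) :=
  Set.range fun g : Matrix.SpecialLinearGroup (Fin q) ℝ => slAct g C

/-- The moment map `m₁(C) = -2 ∑ (C^α)²` of the action of `GL_q(ℝ)` on `so(q)^p`. -/
def momentGL {q p : ℕ} (C : SkewTuple q p) : Matrix (Fin q) (Fin q) ℝ :=
  (-2 : ℝ) • ∑ k, (C k).1 * (C k).1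

/-- The moment map of the action of `SL_q(ℝ)`: the orthogonal projection of `m₁(C)` to the
trace-free matrices. -/
def momentSL {q p : ℕ} (C : SkewTuple q p) : Matrix (Fin q) (Fin q) ℝ :=
  momentGL C - ((momentGL C).trace / (q : ℝ)) • (1 : Matrix (Fin q) (Fin q) ℝ)

/-- `C` is `SL_q(ℝ)`-minimal: `m(C) · C = 0`, where `X · C = (X C¹ + C¹ Xᵗ, …, X Cᵖ + Cᵖ Xᵗ)`. -/
def IsSLMinimal {q p : ℕ} (C : SkewTuple q p) : Prop :=
  ∀ k, momentSL C * (C k).1 + (C k).1 * (momentSL C)ᵀ = 0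

/-- The matrices `C¹, …, Cᵖ` have no common nontrivial proper invariant subspace. -/
def ActsIrreducibly {q p : ℕ} (C : SkewTuple q p) : Prop :=
  ∀ W : Submodule ℝ (Fin q → ℝ), (∀ k, ∀ w ∈ W, (C k).1 *ᵥ w ∈ W) → W = ⊥ ∨ W = ⊤

/-! ### The two-step nilpotent Lie algebra and Lie group of a tuple -/

/-- The space `ℝ^q ⊕ ℝ^p`. It underlies the Lie algebra `𝔑_C`, and, in exponential coordinates,
the simply connected Lie group `N_C`. The second summand is the central subalgebra `𝔷` (the
commutator, if `C` is linearly independent), and the central subgroup `Z`. -/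
abbrev Nil (q p : ℕ) : Type := Fin q ⊕ Fin p → ℝ

/-- The horizontal coordinates; this is the projection `N → N/Z = ℝ^q`. -/
def Nil.hor {q p : ℕ} (u : Nil q p) : Fin q → ℝ := fun i => u (Sum.inl i)

/-- The central coordinates. -/
def Nil.ver {q p : ℕ} (u : Nil q p) : Fin p → ℝ := fun k => u (Sum.inr k)

/-- The Lie bracket of `𝔑_C`: `[e_i, e_j] = ∑ C^k_{ij} e_{q+k}` for `i, j ≤ q`, and all other
brackets of basis vectors vanish. -/
def bracket {q p : ℕ} (C : SkewTuple q p) (u v : Nil q p) : Nil q p :=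
  Sum.elim 0 fun k => u.hor ⬝ᵥ ((C k).1 *ᵥ v.hor)

/-- The multiplication of `N_C` in exponential coordinates, `x · y = x + y + ½ [x, y]`. -/
def mul {q p : ℕ} (C : SkewTuple q p) (x y : Nil q p) : Nil q p :=
  x + y + (1 / 2 : ℝ) • bracket C x y

theorem bracket_hor {q p : ℕ} (C : SkewTuple q p) (u v : Nil q p) :
    (bracket C u v).hor = 0 := by
  ext i; simp [bracket, Nil.hor]

theorem bracket_self {q p : ℕ} (C : SkewTuple q p) (u : Nil q p) : bracket C u u = 0 := by
  ext s
  rcases s with i | k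
  · simp [bracket]
  · have h := (LieAlgebra.Orthogonal.mem_so (Fin q) ℝ (C k).1).1 (C k).2
    have h2 : u.hor ⬝ᵥ ((C k).1 *ᵥ u.hor) = -(u.hor ⬝ᵥ ((C k).1 *ᵥ u.hor)) := by
      conv_lhs => rw [Matrix.dotProduct_mulVec, ← Matrix.mulVec_transpose, h, dotProduct_comm]
      simp [Matrix.neg_mulVec]
    have h3 : u.hor ⬝ᵥ ((C k).1 *ᵥ u.hor) = 0 := by linarith
    simpa [bracket] using h3

theorem mul_zero' {q p : ℕ} (C : SkewTuple q p) (x : Nil q p) : mul C x 0 = x := by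
  ext s
  rcases s with i | k
  · simp [mul, bracket]
  · have h : (0 : Nil q p).hor = 0 := rfl
    simp [mul, bracket, h]

theorem zero_mul' {q p : ℕ} (C : SkewTuple q p) (x : Nil q p) : mul C 0 x = x := by
  ext s
  rcases s with i | k
  · simp [mul, bracket]
  · have h : (0 : Nil q p).hor = 0 := rfl
    simp [mul, bracket, h]

/-- In exponential coordinates, the inverse of `x` is `-x`. -/
theorem neg_mul_self {q p : ℕ} (C : SkewTuple q p) (x : Nil q p) : mul C (-x) x = 0 := by
  have h := bracket_self C x
  have h1 : bracket C (-x) x = -bracket C x x := by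
    have e : (-x : Nil q p).hor = -x.hor := rfl
    ext s
    rcases s with i | k <;> simp [bracket, e]
  simp [mul, h1, h]

theorem mul_assoc' {q p : ℕ} (C : SkewTuple q p) (x y z : Nil q p) :
    mul C (mul C x y) z = mul C x (mul C y z) := by
  have e : ∀ a b : Nil q p, (mul C a b).hor = a.hor + b.hor := by
    intro a b; ext i; simp [mul, Nil.hor, bracket]
  ext s
  rcases s with i | k
  · simp [mul, bracket, add_assoc]
  · have e1 := e x y
    have e2 := e y z
    have k1 : ∀ a b : Nil q p, mul C a b (Sum.inr k)
        = a (Sum.inr k) + b (Sum.inr k) + 1 / 2 * (a.hor ⬝ᵥ ((C k).1 *ᵥ b.hor)) := by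
      intro a b; simp [mul, bracket]
    rw [k1, k1, k1, k1, e1, e2, Matrix.mulVec_add, dotProduct_add, add_dotProduct]
    ring

/-- The Maurer–Cartan form of `N_C`: the tangent vector `u` at `n` is moved to the identity by
left translation with `n⁻¹ = -n`. -/
def maurerCartan {q p : ℕ} (C : SkewTuple q p) (n u : Nil q p) : Nil q p :=
  fderiv ℝ (fun m => mul C (-n) m) n u

/-! ### Left-invariant metrics

A left-invariant Riemannian metric `h` on `N_C` is given by its value at the identity, which is an
inner product on `𝔑_C`, that is, by a positive definite matrix `B`. -/

/-- The inner product with Gram matrix `B`. -/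
def ip {q p : ℕ} (B : Matrix (Fin q ⊕ Fin p) (Fin q ⊕ Fin p) ℝ) (u v : Nil q p) : ℝ :=
  u ⬝ᵥ (B *ᵥ v)

/-- The orthogonal projection `𝔑 → 𝔷` for the inner product `B`. Its kernel is the horizontal
space `ℋ = 𝔷^⊥`. -/
def vertProj {q p : ℕ} (B : Matrix (Fin q ⊕ Fin p) (Fin q ⊕ Fin p) ℝ) (u : Nil q p) :
    Fin p → ℝ :=
  u.ver + B.toBlocks₂₂⁻¹ *ᵥ (B.toBlocks₂₁ *ᵥ u.hor)

/-- The horizontal lift to `ℋ = 𝔷^⊥` of a vector of `𝔑/𝔷 = ℝ^q`. -/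
def horLift {q p : ℕ} (B : Matrix (Fin q ⊕ Fin p) (Fin q ⊕ Fin p) ℝ) (v : Fin q → ℝ) :
    Nil q p :=
  Sum.elim v (-(B.toBlocks₂₂⁻¹ *ᵥ (B.toBlocks₂₁ *ᵥ v)))

/-- The metric induced on the base `N/Z = ℝ^q`: it is left-invariant, hence constant in the
coordinates of the abelian group `ℝ^q`, and the horizontal lift is isometric. -/
def baseMetric {q p : ℕ} (B : Matrix (Fin q ⊕ Fin p) (Fin q ⊕ Fin p) ℝ) :
    (Fin q → ℝ) → Matrix (Fin q) (Fin q) ℝ := fun _ =>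
  Matrix.of fun i j => ip B (horLift B (Pi.single i 1)) (horLift B (Pi.single j 1))

/-- The metric induced on the Lie algebra `𝔷 = ℝ^p` of the structure group. -/
def fiberMetric {q p : ℕ} (B : Matrix (Fin q ⊕ Fin p) (Fin q ⊕ Fin p) ℝ) :
    Matrix (Fin p) (Fin p) ℝ := B.toBlocks₂₂

/-- The left-invariant connection form of the principal bundle `N → N/Z` that vanishes on `ℋ` and
is the identity on `𝔷`. -/
def connForm {q p : ℕ} (C : SkewTuple q p) (B : Matrix (Fin q ⊕ Fin p) (Fin q ⊕ Fin p) ℝ)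
    (n u : Nil q p) : Fin p → ℝ :=
  vertProj B (maurerCartan C n u)

/-- The curvature form `Ω = dω` on `N` (the structure group is abelian). -/
def curvForm {q p : ℕ} (C : SkewTuple q p) (B : Matrix (Fin q ⊕ Fin p) (Fin q ⊕ Fin p) ℝ)
    (n u v : Nil q p) : Fin p → ℝ :=
  fderiv ℝ (fun m => connForm C B m v) n u - fderiv ℝ (fun m => connForm C B m u) n v

/-- The global section `x ↦ (x, 0)` of `N → N/Z`. -/
def sect {q p : ℕ} (x : Fin q → ℝ) : Nil q p := Sum.elim x 0

/-- The curvature `Ω̃ = s^* Ω` on the base; `baseCurv C B α x i j` is the component `Ω̃^α_{ij}`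
at the point `x`. -/
def baseCurv {q p : ℕ} (C : SkewTuple q p) (B : Matrix (Fin q ⊕ Fin p) (Fin q ⊕ Fin p) ℝ)
    (α : Fin p) (x : Fin q → ℝ) : Matrix (Fin q) (Fin q) ℝ :=
  Matrix.of fun i j => curvForm C B (sect x) (fderiv ℝ (sect (p := p)) x (Pi.single i 1))
    (fderiv ℝ (sect (p := p)) x (Pi.single j 1)) α

/-! ### Riemannian calculus in the global coordinates of `ℝ^q` -/

/-- The partial derivative `∂_i f`. -/
def pd {q : ℕ} (i : Fin q) (f : (Fin q → ℝ) → ℝ) (x : Fin q → ℝ) : ℝ :=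
  fderiv ℝ f x (Pi.single i 1)

/-- The Christoffel symbol `Γ^k_{ij}` of the metric `g`. -/
def christoffel {q : ℕ} (g : (Fin q → ℝ) → Matrix (Fin q) (Fin q) ℝ) (k i j : Fin q)
    (x : Fin q → ℝ) : ℝ :=
  (1 / 2 : ℝ) * ∑ l, (g x)⁻¹ k l *
    (pd i (fun y => g y j l) x + pd j (fun y => g y i l) x - pd l (fun y => g y i j) x)

/-- The Ricci tensor `Rc_{ij}` of the metric `g`. -/
def ricci {q : ℕ} (g : (Fin q → ℝ) → Matrix (Fin q) (Fin q) ℝ) (i j : Fin q)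
    (x : Fin q → ℝ) : ℝ :=
  ∑ k, (pd k (christoffel g k i j) x - pd j (christoffel g k i k) x
    + ∑ l, (christoffel g k k l x * christoffel g l i j x
      - christoffel g k j l x * christoffel g l i k x))

/-- The codifferential of a 2-form, `(δΩ)_j = - g^{kl} ∇_k Ω_{lj}`. -/
def codiff2 {q : ℕ} (g Om : (Fin q → ℝ) → Matrix (Fin q) (Fin q) ℝ) (j : Fin q)
    (x : Fin q → ℝ) : ℝ :=
  -∑ k, ∑ l, (g x)⁻¹ k l * (pd k (fun y => Om y l j) x
    - ∑ m, (christoffel g m k l x * Om x m j + christoffel g m k j x * Om x l m))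

/-- The exterior derivative of a 2-form. -/
def extd2 {q : ℕ} (Om : (Fin q → ℝ) → Matrix (Fin q) (Fin q) ℝ) (i j k : Fin q)
    (x : Fin q → ℝ) : ℝ :=
  pd i (fun y => Om y j k) x + pd j (fun y => Om y k i) x + pd k (fun y => Om y i j) x

/-- The codifferential of a 3-form, `(δη)_{ij} = - g^{kl} ∇_k η_{lij}`. -/
def codiff3 {q : ℕ} (g : (Fin q → ℝ) → Matrix (Fin q) (Fin q) ℝ)
    (η : Fin q → Fin q → Fin q → (Fin q → ℝ) → ℝ) (i j : Fin q) (x : Fin q → ℝ) : ℝ :=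
  -∑ k, ∑ l, (g x)⁻¹ k l * (pd k (η l i j) x
    - ∑ m, (christoffel g m k l x * η m i j x + christoffel g m k i x * η l m j x
      + christoffel g m k j x * η l i m x))

/-- The Hodge Laplacian `Δ_d = -(dδ + δd)` on 2-forms, with the sign for which the Yang–Mills heat
flow `∂ω/∂t = -δΩ` gives `∂Ω/∂t = Δ_d Ω`. -/
def hodgeLaplacian {q : ℕ} (g Om : (Fin q → ℝ) → Matrix (Fin q) (Fin q) ℝ) (i j : Fin q)
    (x : Fin q → ℝ) : ℝ :=
  -(pd i (codiff2 g Om j) x - pd j (codiff2 g Om i) x + codiff3 g (extd2 Om) i j x)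

/-- The Lie derivative `L_X T` of a 2-tensor. -/
def lieDer {q : ℕ} (X : (Fin q → ℝ) → (Fin q → ℝ))
    (T : (Fin q → ℝ) → Matrix (Fin q) (Fin q) ℝ) (i j : Fin q) (x : Fin q → ℝ) : ℝ :=
  ∑ k, (X x k * pd k (fun y => T y i j) x + T x k j * pd i (fun y => X y k) x
    + T x i k * pd j (fun y => X y k) x)

/-- `Ω̃²_{ij} = g^{kl} k_{αβ} Ω̃^α_{ki} Ω̃^β_{lj}`. -/
def curvSq {q p : ℕ} (g : (Fin q → ℝ) → Matrix (Fin q) (Fin q) ℝ)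
    (κ : Matrix (Fin p) (Fin p) ℝ) (Om : Fin p → (Fin q → ℝ) → Matrix (Fin q) (Fin q) ℝ)
    (i j : Fin q) (x : Fin q → ℝ) : ℝ :=
  ∑ k, ∑ l, ∑ α, ∑ β, (g x)⁻¹ k l * κ α β * Om α x k i * Om β x l j

/-- The Ricci Yang–Mills soliton equations on the base `ℝ^q`, for the metric `g`, the metric `κ` on
the Lie algebra of the structure group, the curvature `Om`, the constant `lam` and the vector
field `X`:
`Ω̃² - 2 Rc(g) = λ g + L_X g` and `Δ_d Ω̃ = L_X Ω̃`. -/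
def IsRYMSolitonOnBase {q p : ℕ} (g : (Fin q → ℝ) → Matrix (Fin q) (Fin q) ℝ)
    (κ : Matrix (Fin p) (Fin p) ℝ) (Om : Fin p → (Fin q → ℝ) → Matrix (Fin q) (Fin q) ℝ)
    (lam : ℝ) (X : (Fin q → ℝ) → (Fin q → ℝ)) : Prop :=
  ContDiff ℝ ∞ X ∧
  (∀ i j x, curvSq g κ Om i j x - 2 * ricci g i j x = lam * g x i j + lieDer X g i j x) ∧
  (∀ α i j x, hodgeLaplacian g (Om α) i j x = lieDer X (Om α) i j x)

/-- The left-invariant metric `B` on `N_C` is a Ricci Yang–Mills soliton, with constant `lam` and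
generating vector field `X` on `N/Z`. -/
def IsRYMSoliton {q p : ℕ} (C : SkewTuple q p) (B : Matrix (Fin q ⊕ Fin p) (Fin q ⊕ Fin p) ℝ)
    (lam : ℝ) (X : (Fin q → ℝ) → (Fin q → ℝ)) : Prop :=
  IsRYMSolitonOnBase (baseMetric B) (fiberMetric B) (baseCurv C B) lam X

/-- A trivial Ricci Yang–Mills soliton is one that is generated by `X = 0`. -/
def IsTrivialRYMSoliton {q p : ℕ} (C : SkewTuple q p)
    (B : Matrix (Fin q ⊕ Fin p) (Fin q ⊕ Fin p) ℝ) : Prop :=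
  ∃ lam : ℝ, IsRYMSoliton C B lam 0

/-! ### Structure matrices of a left-invariant metric -/

/-- `D` is the tuple of structure matrices of the metric Lie algebra `(𝔑_C, B)` with respect to
some orthonormal basis `X_1, …, X_q, Z_1, …, Z_p` with `Z_k ∈ 𝔷`. -/
def IsStructureTuple {q p : ℕ} (C : SkewTuple q p)
    (B : Matrix (Fin q ⊕ Fin p) (Fin q ⊕ Fin p) ℝ) (D : SkewTuple q p) : Prop :=
  ∃ (X : Fin q → Nil q p) (Z : Fin p → Nil q p),
    (∀ i j, ip B (X i) (X j) = if i = j then 1 else 0) ∧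
    (∀ k l, ip B (Z k) (Z l) = if k = l then 1 else 0) ∧
    (∀ i k, ip B (X i) (Z k) = 0) ∧
    (∀ k, (Z k).hor = 0) ∧
    (∀ i j, bracket C (X i) (X j) = ∑ k, (D k).1 i j • Z k)

/-! ### The Ricci tensor and the geodesics of a left-invariant metric -/

/-- The Levi-Civita connection on left-invariant vector fields, from the Koszul formula
`2⟨∇_u v, w⟩ = ⟨[u, v], w⟩ - ⟨[v, w], u⟩ + ⟨[w, u], v⟩`. -/
def leviCivita {q p : ℕ} (C : SkewTuple q p) (B : Matrix (Fin q ⊕ Fin p) (Fin q ⊕ Fin p) ℝ)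
    (u v : Nil q p) : Nil q p :=
  (1 / 2 : ℝ) • (B⁻¹ *ᵥ fun s =>
    ip B (bracket C u v) (Pi.single s 1) - ip B (bracket C v (Pi.single s 1)) u
      + ip B (bracket C (Pi.single s 1) u) v)

/-- The curvature `R(u, v)w = ∇_u ∇_v w - ∇_v ∇_u w - ∇_{[u, v]} w`. -/
def riemann {q p : ℕ} (C : SkewTuple q p) (B : Matrix (Fin q ⊕ Fin p) (Fin q ⊕ Fin p) ℝ)
    (u v w : Nil q p) : Nil q p :=
  leviCivita C B u (leviCivita C B v w) - leviCivita C B v (leviCivita C B u w)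
    - leviCivita C B (bracket C u v) w

/-- The left-invariant Ricci tensor of `N_C`: `Ric(v, w)` is the trace of `u ↦ R(u, v)w`. -/
def ricciNil {q p : ℕ} (C : SkewTuple q p) (B : Matrix (Fin q ⊕ Fin p) (Fin q ⊕ Fin p) ℝ)
    (v w : Nil q p) : ℝ :=
  ∑ s, riemann C B (Pi.single s 1) v w s

/-- The curve `γ` in `N_C` is, on the interval `(a, b)`, a geodesic with left-trivialised velocity
`v`, that is, `v` is the Maurer–Cartan form of `γ'` and `v' + ∇_v v = 0`. -/
def IsGeodesicOn {q p : ℕ} (C : SkewTuple q p) (B : Matrix (Fin q ⊕ Fin p) (Fin q ⊕ Fin p) ℝ)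
    (γ v : ℝ → Nil q p) (a b : ℝ) : Prop :=
  ∀ t ∈ Set.Ioo a b, DifferentiableAt ℝ γ t ∧ v t = maurerCartan C (γ t) (deriv γ t) ∧
    HasDerivAt v (-leviCivita C B (v t) (v t)) t

/-- The Ricci tensor is invariant under the geodesic flow: `Ric(γ', γ')` is constant along every
geodesic `γ`. -/
def RicciIsGeodesicFlowInvariant {q p : ℕ} (C : SkewTuple q p)
    (B : Matrix (Fin q ⊕ Fin p) (Fin q ⊕ Fin p) ℝ) : Prop :=
  ∀ (γ v : ℝ → Nil q p) (a b : ℝ), IsGeodesicOn C B γ v a b →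
    ∀ t ∈ Set.Ioo a b, ∀ s ∈ Set.Ioo a b,
      ricciNil C B (v t) (v t) = ricciNil C B (v s) (v s)

end RYM

end

/-!
The base `ℝ^q` of a left-invariant metric carries a constant metric `g`, and its curvature is the
constant form `-C^α`. Hence the Christoffel symbols vanish, the curvature is harmonic, and a
trivial Ricci Yang–Mills soliton is the same thing as a solution of the algebraic equation
`Ω̃² = λ g` (`isRYMSolitonOnBase_const_iff`). In an orthonormal frame adapted to the centre, with
structure matrices `D^k`, this equation says that `S = ∑ (D^k)²` is a scalar matrix
(`IsFrame.isTrivialRYMSoliton_iff`). Everything else is a reformulation of that condition.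

* The moment map `m(D)` is a multiple of the trace-free part of `S`. If `m(D)` annihilates `D`, it
  anticommutes with each `D^k`, so `tr (m²) = -2 ∑ tr (m (D^k)²) = 0` and `m = 0`. Thus minimality
  means that `S` is scalar (`isSLMinimal_iff_momentSL`, `momentSL_eq_zero_iff`).
* A closed orbit contains a tuple of minimal norm. Stationarity of the norm along
  `t ↦ det (1 + t m) ^ (-1 / q) (1 + t m)` gives `tr (m²) = 0` there
  (`momentSL_eq_zero_of_minimal`). The group element that moves `C` to this tuple is used as an
  orthonormal frame, and this defines the metric.
* A frame is an isometric isomorphism of metric Lie algebras, so it carries the Levi-Civita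
  connection and the Ricci tensor along. For the standard inner product and `v = (x, z)`, with
  `J_z = ∑ z_k D^k`, one has `∇_v v = (J_z x, 0)` and
  `Ric(v, v) = ½ ⟨x, S x⟩ - ¼ tr (J_z²)`. Along a geodesic the derivative of `Ric(v, v)` is
  therefore `-⟨J_z x, S x⟩`. As geodesics exist for all initial velocities, the Ricci tensor is
  invariant under the geodesic flow if and only if `S` commutes with every `D^k`
  (`IsFrame.ricciIsGeodesicFlowInvariant_iff`). A scalar `S` commutes with everything; conversely,
  the eigenspaces of a symmetric `S` that commutes with an irreducible tuple are invariant, so `S`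
  is scalar (`ActsIrreducibly.exists_eq_smul_one`).
-/

noncomputable section

namespace RYM

variable {p q : ℕ}

/-! ### Elementary facts on tuples and brackets -/

theorem SkewTuple.transpose_eq (C : SkewTuple q p) (k : Fin p) : (C k).1ᵀ = -(C k).1 :=
  (LieAlgebra.Orthogonal.mem_so (Fin q) ℝ (C k).1).1 (C k).2

theorem SkewTuple.dotProduct_mulVec_swap (C : SkewTuple q p) (k : Fin p) (u v : Fin q → ℝ) :
    u ⬝ᵥ ((C k).1 *ᵥ v) = -(v ⬝ᵥ ((C k).1 *ᵥ u)) := by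
  rw [Matrix.dotProduct_mulVec, ← Matrix.mulVec_transpose, C.transpose_eq, dotProduct_comm,
    Matrix.neg_mulVec, dotProduct_neg]

/-- The Lie bracket of `𝔑_C` as a bilinear map. -/
def bracketLin (C : SkewTuple q p) : Nil q p →ₗ[ℝ] Nil q p →ₗ[ℝ] Nil q p :=
  LinearMap.mk₂ ℝ (bracket C)
    (fun u u' v => by
      have e : (u + u').hor = u.hor + u'.hor := rfl
      ext s; rcases s with i | k <;> simp [bracket, e, add_dotProduct])
    (fun c u v => by
      have e : (c • u).hor = c • u.hor := rfl
      ext s; rcases s with i | k <;> simp [bracket, e])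
    (fun u v v' => by
      have e : (v + v').hor = v.hor + v'.hor := rfl
      ext s; rcases s with i | k <;> simp [bracket, e, Matrix.mulVec_add, dotProduct_add])
    (fun c u v => by
      have e : (c • v).hor = c • v.hor := rfl
      ext s; rcases s with i | k <;> simp [bracket, e, Matrix.mulVec_smul])

@[simp] theorem bracketLin_apply (C : SkewTuple q p) (u v : Nil q p) :
    bracketLin C u v = bracket C u v := rfl

theorem bracket_swap (C : SkewTuple q p) (u v : Nil q p) : bracket C u v = -bracket C v u := by
  ext s
  rcases s with i | k
  · simp [bracket]
  · simpa [bracket] using C.dotProduct_mulVec_swap k u.hor v.hor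

/-! ### The data on the base are constant -/

theorem maurerCartan_eq (C : SkewTuple q p) (n u : Nil q p) :
    maurerCartan C n u = u - (1 / 2 : ℝ) • bracket C n u := by
  have h : HasFDerivAt (fun m => mul C (-n) m)
      (ContinuousLinearMap.id ℝ (Nil q p)
        + (1 / 2 : ℝ) • LinearMap.toContinuousLinearMap (bracketLin C (-n))) n := by
    have h1 := (LinearMap.toContinuousLinearMap (bracketLin C (-n))).hasFDerivAt (x := n)
    exact ((hasFDerivAt_id n).const_add (-n)).add (h1.const_smul (1 / 2 : ℝ))
  rw [maurerCartan, h.fderiv]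
  simp [sub_eq_add_neg]

theorem connForm_eq (C : SkewTuple q p) (B : Matrix (Fin q ⊕ Fin p) (Fin q ⊕ Fin p) ℝ)
    (n u : Nil q p) : connForm C B n u = vertProj B u - (1 / 2 : ℝ) • (bracket C n u).ver := by
  have h : (u - (1 / 2 : ℝ) • bracket C n u).hor = u.hor := by
    ext i; simp [Nil.hor, bracket]
  rw [connForm, maurerCartan_eq, vertProj, h, vertProj]
  ext k
  simp [Nil.ver]
  ring

/-- The curvature form of the left-invariant connection is minus the central part of the
bracket, for every choice of the horizontal space. -/
theorem curvForm_eq (C : SkewTuple q p) (B : Matrix (Fin q ⊕ Fin p) (Fin q ⊕ Fin p) ℝ)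
    (n u v : Nil q p) : curvForm C B n u v = -(bracket C u v).ver := by
  have key : ∀ a b : Nil q p, fderiv ℝ (fun m => connForm C B m a) n b
      = -((1 / 2 : ℝ) • (bracket C b a).ver) := by
    intro a b
    let L : Nil q p →ₗ[ℝ] (Fin p → ℝ) :=
      { toFun := fun m => (bracket C m a).ver
        map_add' := fun x y => by
          have h := congrArg (fun f => f a) ((bracketLin C).map_add x y)
          exact congrArg Nil.ver h
        map_smul' := fun c x => by
          have h := congrArg (fun f => f a) ((bracketLin C).map_smul c x)
          exact congrArg Nil.ver h }
    have h : HasFDerivAt (fun m => connForm C B m a)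
        (-((1 / 2 : ℝ) • LinearMap.toContinuousLinearMap L)) n := by
      simp_rw [connForm_eq]
      exact ((LinearMap.toContinuousLinearMap L).hasFDerivAt.const_smul (1 / 2 : ℝ)).const_sub _
    rw [h.fderiv]
    rfl
  have h : (bracket C v u).ver = -(bracket C u v).ver := by rw [bracket_swap]; rfl
  rw [curvForm, key, key, h]
  ext k
  simp
  ring

theorem baseCurv_eq (C : SkewTuple q p) (B : Matrix (Fin q ⊕ Fin p) (Fin q ⊕ Fin p) ℝ)
    (α : Fin p) (x : Fin q → ℝ) : baseCurv C B α x = -(C α).1 := by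
  let L : (Fin q → ℝ) →ₗ[ℝ] Nil q p :=
    { toFun := sect
      map_add' := fun x y => by ext s; rcases s with i | k <;> simp [sect]
      map_smul' := fun c x => by ext s; rcases s with i | k <;> simp [sect] }
  have h : ∀ v, fderiv ℝ (sect (q := q) (p := p)) x v = sect v := fun v => by
    have := (LinearMap.toContinuousLinearMap L).hasFDerivAt (x := x)
    have h' : HasFDerivAt (sect (q := q) (p := p)) (LinearMap.toContinuousLinearMap L) x := this
    rw [h'.fderiv]; rfl
  have hh : ∀ v, (sect (q := q) (p := p) v).hor = v := fun v => rfl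
  ext i j
  simp [baseCurv, h, curvForm_eq, Nil.ver, bracket, hh]

/-- The matrix of the horizontal lift `ℝ^q → ℋ`; the base metric is the pull-back of `B` under
it. -/
def horLiftMatrix (B : Matrix (Fin q ⊕ Fin p) (Fin q ⊕ Fin p) ℝ) :
    Matrix (Fin q ⊕ Fin p) (Fin q) ℝ :=
  Matrix.fromRows 1 (-(B.toBlocks₂₂⁻¹ * B.toBlocks₂₁))

theorem horLift_eq (B : Matrix (Fin q ⊕ Fin p) (Fin q ⊕ Fin p) ℝ) (v : Fin q → ℝ) :
    horLift B v = horLiftMatrix B *ᵥ v := by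
  rw [horLiftMatrix, Matrix.fromRows_mulVec, horLift]
  simp [Matrix.neg_mulVec, Matrix.mulVec_mulVec]

theorem ip_mulVec {m : Type*} [Fintype m] (B : Matrix (Fin q ⊕ Fin p) (Fin q ⊕ Fin p) ℝ)
    (M N : Matrix (Fin q ⊕ Fin p) m ℝ) (a b : m → ℝ) :
    ip B (M *ᵥ a) (N *ᵥ b) = a ⬝ᵥ ((Mᵀ * B * N) *ᵥ b) := by
  rw [ip, ← Matrix.mulVec_mulVec, ← Matrix.mulVec_mulVec, Matrix.dotProduct_mulVec a,
    Matrix.vecMul_transpose]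

theorem baseMetric_eq (B : Matrix (Fin q ⊕ Fin p) (Fin q ⊕ Fin p) ℝ) :
    baseMetric B = fun _ => (horLiftMatrix B)ᵀ * B * horLiftMatrix B := by
  ext x i j
  simp only [baseMetric, Matrix.of_apply, horLift_eq, ip_mulVec]
  simp

/-- For constant data on the base, the equations of a trivial Ricci Yang–Mills soliton reduce to a
single algebraic equation: all Christoffel symbols vanish and the curvature is harmonic. -/
theorem isRYMSolitonOnBase_const_iff (G : Matrix (Fin q) (Fin q) ℝ) (κ : Matrix (Fin p) (Fin p) ℝ)
    (Ω : Fin p → Matrix (Fin q) (Fin q) ℝ) (lam : ℝ) :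
    IsRYMSolitonOnBase (fun _ => G) κ (fun α _ => Ω α) lam 0 ↔
      ∑ α, ∑ β, κ α β • ((Ω α)ᵀ * G⁻¹ * Ω β) = lam • G := by
  have hpd : ∀ (i : Fin q) (c : ℝ) (x : Fin q → ℝ), pd i (fun _ => c) x = 0 := by
    intro i c x; simp [pd]
  have hch : ∀ k i j : Fin q, christoffel (fun _ => G) k i j = fun _ => 0 := by
    intro k i j; ext x; simp [christoffel, hpd]
  have hri : ∀ (i j : Fin q) x, ricci (fun _ => G) i j x = 0 := by
    intro i j x; simp [ricci, hch, hpd]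
  have hcd : ∀ α (j : Fin q), codiff2 (fun _ => G) (fun _ => Ω α) j = fun _ => 0 := by
    intro α j; ext x; simp [codiff2, hch, hpd]
  have hext : ∀ α, extd2 (fun _ : Fin q → ℝ => Ω α) = fun _ _ _ _ => 0 := by
    intro α; ext i j k x; simp [extd2, hpd]
  have hho : ∀ α (i j : Fin q) x, hodgeLaplacian (fun _ => G) (fun _ => Ω α) i j x = 0 := by
    intro α i j x; simp [hodgeLaplacian, hcd, hext, codiff3, hpd]
  have hli : ∀ (T : Matrix (Fin q) (Fin q) ℝ) (i j : Fin q) x,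
      lieDer 0 (fun _ => T) i j x = 0 := by
    intro T i j x; simp [lieDer, hpd]
  have hsq : ∀ (i j : Fin q) x, curvSq (fun _ => G) κ (fun α _ => Ω α) i j x
      = (∑ α, ∑ β, κ α β • ((Ω α)ᵀ * G⁻¹ * Ω β)) i j := by
    intro i j x
    simp only [curvSq, Matrix.sum_apply, Matrix.smul_apply, Matrix.mul_apply, smul_eq_mul,
      Matrix.transpose_apply, Finset.sum_mul, Finset.mul_sum]
    rw [Finset.sum_comm]
    simp_rw [Finset.sum_comm (s := (Finset.univ : Finset (Fin q)))
      (t := (Finset.univ : Finset (Fin p)))]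
    refine Finset.sum_congr rfl fun α _ => Finset.sum_congr rfl fun β _ =>
      Finset.sum_congr rfl fun l _ => Finset.sum_congr rfl fun k _ => by ring
  constructor
  · rintro ⟨-, h, -⟩
    ext i j
    have := h i j 0
    rw [hsq, hri, hli] at this
    simpa using this
  · intro h
    refine ⟨contDiff_const, fun i j x => ?_, fun α i j x => ?_⟩
    · rw [hsq, hri, hli, h]; simp
    · rw [hho, hli]

/-- A metric is a trivial soliton when `∑ κ_{αβ} (C^α)ᵗ g⁻¹ C^β = λ g` for the constant base metric
`g`. -/
theorem isTrivialRYMSoliton_iff (C : SkewTuple q p)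
    (B : Matrix (Fin q ⊕ Fin p) (Fin q ⊕ Fin p) ℝ) :
    IsTrivialRYMSoliton C B ↔ ∃ lam : ℝ,
      ∑ α, ∑ β, B.toBlocks₂₂ α β •
        ((C α).1ᵀ * ((horLiftMatrix B)ᵀ * B * horLiftMatrix B)⁻¹ * (C β).1)
      = lam • ((horLiftMatrix B)ᵀ * B * horLiftMatrix B) := by
  have h : baseCurv C B = fun α _ => -(C α).1 := by ext1 α; ext1 x; exact baseCurv_eq C B α x
  unfold IsTrivialRYMSoliton IsRYMSoliton fiberMetric
  simp_rw [h, baseMetric_eq, isRYMSolitonOnBase_const_iff]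
  simp

/-! ### Orthonormal frames -/

/-- An adapted orthonormal frame of `(𝔑_C, B)` with structure matrices `D`: the columns of `F` are
`X_1, …, X_q, Z_1, …, Z_p`. The vanishing of the upper right block says that the `Z_k` lie in `𝔷`;
the bracket relations are stated for the projections of the `X_i` to `ℝ^q`. -/
structure IsFrame (C : SkewTuple q p) (B : Matrix (Fin q ⊕ Fin p) (Fin q ⊕ Fin p) ℝ)
    (D : SkewTuple q p) (F : Matrix (Fin q ⊕ Fin p) (Fin q ⊕ Fin p) ℝ) : Prop where
  orthonormal : Fᵀ * B * F = 1
  vertical : F.toBlocks₁₂ = 0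
  structure_eq : ∀ k, F.toBlocks₁₁ᵀ * (C k).1 * F.toBlocks₁₁ = ∑ l, F.toBlocks₂₂ k l • (D l).1

theorem orthonormal_iff (B F : Matrix (Fin q ⊕ Fin p) (Fin q ⊕ Fin p) ℝ) :
    Fᵀ * B * F = 1 ↔ ∀ s t, ip B (F.col s) (F.col t) = if s = t then 1 else 0 := by
  have h : ∀ s t, ip B (F.col s) (F.col t) = (Fᵀ * B * F) s t := by
    intro s t
    rw [← Matrix.mulVec_single_one, ← Matrix.mulVec_single_one, ip_mulVec]
    simp
  simp_rw [h, ← Matrix.one_apply]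
  exact ⟨fun h s t => by rw [h], fun h => Matrix.ext h⟩

/-- Structure tuples are the structure matrices of adapted orthonormal frames. -/
theorem isStructureTuple_iff {C : SkewTuple q p} {B : Matrix (Fin q ⊕ Fin p) (Fin q ⊕ Fin p) ℝ}
    (hB : Bᵀ = B) {D : SkewTuple q p} : IsStructureTuple C B D ↔ ∃ F, IsFrame C B D F := by
  have hbr : ∀ (F : Matrix (Fin q ⊕ Fin p) (Fin q ⊕ Fin p) ℝ) (i j : Fin q) (k : Fin p),
      bracket C (F.col (Sum.inl i)) (F.col (Sum.inl j)) (Sum.inr k)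
        = (F.toBlocks₁₁ᵀ * (C k).1 * F.toBlocks₁₁) i j := by
    intro F i j k
    have e : ∀ i, (Nil.hor (F.col (Sum.inl i) : Nil q p)) = F.toBlocks₁₁ *ᵥ Pi.single i 1 := by
      intro i; rw [Matrix.mulVec_single_one]; rfl
    simp only [bracket, Sum.elim_inr, e]
    rw [← Matrix.vecMul_transpose, ← Matrix.dotProduct_mulVec, Matrix.mulVec_mulVec,
      Matrix.mulVec_mulVec]
    simp [Matrix.mul_assoc]
  constructor
  · rintro ⟨X, Z, hX, hZ, hXZ, hv, hb⟩
    refine ⟨Matrix.of fun s t => Sum.elim X Z t s, (orthonormal_iff _ _).2 ?_, ?_, fun k => ?_⟩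
    · rintro (i | k) (j | l)
      · simpa using! hX i j
      · simpa using! hXZ i l
      · have := hXZ j k
        have h0 : ip B (Z k) (X j) = 0 := by
          rw [← this, ip, ip, Matrix.dotProduct_mulVec, ← Matrix.mulVec_transpose, hB,
            dotProduct_comm]
        simpa using! h0
      · simpa using! hZ k l
    · ext i k
      exact congrFun (hv k) i
    · ext i j
      rw [← hbr]
      have h := congrFun (hb i j) (Sum.inr k)
      refine h.trans ?_
      simp [Matrix.sum_apply, Matrix.toBlocks₂₂, mul_comm]
  · rintro ⟨F, hF, hv, hs⟩
    have h := (orthonormal_iff _ _).1 hF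
    refine ⟨fun i => F.col (Sum.inl i), fun k => F.col (Sum.inr k), fun i j => by simp [h],
      fun i j => by simp [h], fun i j => by simp [h], fun k => ?_, fun i j => ?_⟩
    · ext i
      exact congrFun (congrFun hv i) k
    · ext s
      rcases s with a | k
      · have h0 : ∀ l, F (Sum.inl a) (Sum.inr l) = 0 := fun l => congrFun (congrFun hv a) l
        simp [bracket, h0]
      · rw [hbr, hs]
        simp [Matrix.sum_apply, Matrix.toBlocks₂₂, mul_comm]

/-- A positive definite matrix is congruent to the identity. -/
theorem exists_congr_one {n : Type*} [Fintype n] [DecidableEq n] {M : Matrix n n ℝ}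
    (hM : M.PosDef) : ∃ E : Matrix n n ℝ, IsUnit E ∧ Eᵀ * M * E = 1 := by
  open scoped MatrixOrder in
  obtain ⟨y, hy, rfl⟩ := CStarAlgebra.isStrictlyPositive_iff_eq_star_mul_self.1
    hM.isStrictlyPositive
  have hd : IsUnit y.det := (Matrix.isUnit_iff_isUnit_det _).1 hy
  refine ⟨y⁻¹, (Matrix.isUnit_nonsing_inv_iff).2 hy, ?_⟩
  rw [Matrix.star_eq_conjTranspose, Matrix.conjTranspose_eq_transpose_of_trivial,
    Matrix.transpose_nonsing_inv, ← Matrix.mul_assoc, Matrix.mul_assoc, Matrix.mul_nonsing_inv _ hd,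
    Matrix.nonsing_inv_mul _ (by rwa [Matrix.det_transpose]), one_mul]

namespace IsFrame

variable {C D : SkewTuple q p} {B F : Matrix (Fin q ⊕ Fin p) (Fin q ⊕ Fin p) ℝ}

theorem blocks (hF : IsFrame C B D F) :
    F.toBlocks₂₂ᵀ * B.toBlocks₂₂ * F.toBlocks₂₂ = 1 ∧
      F.toBlocks₂₂ᵀ * (B.toBlocks₂₁ * F.toBlocks₁₁ + B.toBlocks₂₂ * F.toBlocks₂₁) = 0 := by
  have h := hF.orthonormal
  rw [← Matrix.fromBlocks_toBlocks F, ← Matrix.fromBlocks_toBlocks B, hF.vertical,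
    Matrix.fromBlocks_transpose, Matrix.fromBlocks_multiply, Matrix.fromBlocks_multiply,
    ← Matrix.fromBlocks_one, Matrix.fromBlocks_inj] at h
  obtain ⟨-, -, h3, h4⟩ := h
  simp only [Matrix.transpose_zero, Matrix.zero_mul, Matrix.mul_zero, zero_add] at h3 h4
  refine ⟨h4, ?_⟩
  rw [← h3]
  simp only [Matrix.mul_add, Matrix.mul_assoc]

/-- The horizontal columns of an adapted frame are the horizontal lifts of their projections. -/
theorem horLiftMatrix_mul (hF : IsFrame C B D F) :
    horLiftMatrix B * F.toBlocks₁₁ = F.submatrix id Sum.inl := by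
  obtain ⟨h4, h3⟩ := hF.blocks
  have hE : IsUnit F.toBlocks₂₂.det := Matrix.isUnit_det_of_left_inverse h4
  have hE' : IsUnit (F.toBlocks₂₂ᵀ).det := by rwa [Matrix.det_transpose]
  have hκ : IsUnit B.toBlocks₂₂.det := by
    have := congrArg Matrix.det h4
    rw [Matrix.det_mul, Matrix.det_mul, Matrix.det_one] at this
    exact IsUnit.of_mul_eq_one (F.toBlocks₂₂ᵀ.det * F.toBlocks₂₂.det) (by rw [← this]; ring)
  have h0 : B.toBlocks₂₁ * F.toBlocks₁₁ + B.toBlocks₂₂ * F.toBlocks₂₁ = 0 := by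
    have := congrArg (fun M => (F.toBlocks₂₂ᵀ)⁻¹ * M) h3
    simpa [← Matrix.mul_assoc, Matrix.nonsing_inv_mul _ hE'] using this
  have h1 : F.toBlocks₂₁ = -(B.toBlocks₂₂⁻¹ * B.toBlocks₂₁) * F.toBlocks₁₁ := by
    rw [Matrix.neg_mul, Matrix.mul_assoc, eq_neg_of_add_eq_zero_left h0, Matrix.mul_neg, neg_neg,
      ← Matrix.mul_assoc, Matrix.nonsing_inv_mul _ hκ, Matrix.one_mul]
  rw [horLiftMatrix, Matrix.fromRows_mul, ← h1]
  ext (i | k) j <;> simp [Matrix.toBlocks₁₁, Matrix.toBlocks₂₁]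

/-- The projections of the horizontal vectors of a frame are orthonormal for the base metric. -/
theorem base_orthonormal (hF : IsFrame C B D F) :
    F.toBlocks₁₁ᵀ * ((horLiftMatrix B)ᵀ * B * horLiftMatrix B) * F.toBlocks₁₁ = 1 := by
  have h : F.toBlocks₁₁ᵀ * ((horLiftMatrix B)ᵀ * B * horLiftMatrix B) * F.toBlocks₁₁
      = (horLiftMatrix B * F.toBlocks₁₁)ᵀ * B * (horLiftMatrix B * F.toBlocks₁₁) := by
    simp only [Matrix.transpose_mul, Matrix.mul_assoc]
  rw [h, hF.horLiftMatrix_mul]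
  have h2 : (F.submatrix id Sum.inl)ᵀ * B * F.submatrix id Sum.inl
      = (Fᵀ * B * F).submatrix Sum.inl Sum.inl := by
    ext i j; simp [Matrix.mul_apply]
  rw [h2, hF.orthonormal]
  ext i j
  simp [Matrix.one_apply]

/-- In an orthonormal frame, the soliton equation `Ω̃² = λ g` says that `∑ (D^k)²` is scalar. -/
theorem isTrivialRYMSoliton_iff (hF : IsFrame C B D F) :
    IsTrivialRYMSoliton C B ↔ ∃ c : ℝ, ∑ k, (D k).1 * (D k).1 = c • 1 := by
  rw [RYM.isTrivialRYMSoliton_iff]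
  have hA := hF.base_orthonormal
  have hE := hF.blocks.1
  have hs := hF.structure_eq
  set G := (horLiftMatrix B)ᵀ * B * horLiftMatrix B
  set A := F.toBlocks₁₁
  set E := F.toBlocks₂₂
  set κ := B.toBlocks₂₂
  have hdA : IsUnit A.det := Matrix.isUnit_det_of_left_inverse hA
  have hdAt : IsUnit Aᵀ.det := by rwa [Matrix.det_transpose]
  have hG : G⁻¹ = A * Aᵀ := by
    apply Matrix.inv_eq_left_inv
    have h := mul_eq_one_comm.1 hA
    rwa [Matrix.mul_assoc]
  have hinj : ∀ M N : Matrix (Fin q) (Fin q) ℝ, M = N ↔ Aᵀ * M * A = Aᵀ * N * A := by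
    intro M N
    refine ⟨fun h => by rw [h], fun h => ?_⟩
    have h1 := congrArg (fun M => Aᵀ⁻¹ * (M * A⁻¹)) h
    simpa [Matrix.mul_assoc, Matrix.mul_nonsing_inv _ hdA,
      Matrix.nonsing_inv_mul_cancel_left _ _ hdAt] using h1
  have key : Aᵀ * (∑ α, ∑ β, κ α β • ((C α).1ᵀ * G⁻¹ * (C β).1)) * A
      = -∑ k, (D k).1 * (D k).1 := by
    have h1 : ∀ α β, Aᵀ * ((C α).1ᵀ * G⁻¹ * (C β).1) * A
        = -∑ l, ∑ m, (E α l * E β m) • ((D l).1 * (D m).1) := by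
      intro α β
      have : Aᵀ * ((C α).1ᵀ * G⁻¹ * (C β).1) * A
          = -((Aᵀ * (C α).1 * A) * (Aᵀ * (C β).1 * A)) := by
        rw [hG, C.transpose_eq]
        simp only [Matrix.neg_mul, Matrix.mul_neg, Matrix.mul_assoc]
      rw [this, hs, hs]
      simp only [Finset.sum_mul, Finset.mul_sum, smul_mul_smul_comm]
      rw [Finset.sum_comm]
    have h2 : ∀ l m, ∑ α, ∑ β, κ α β * (E α l * E β m) = if l = m then 1 else 0 := by
      intro l m
      have := congrFun (congrFun hE l) m
      rw [Matrix.one_apply] at this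
      rw [← this]
      simp only [Matrix.mul_apply, Matrix.transpose_apply, Finset.sum_mul]
      rw [Finset.sum_comm]
      exact Finset.sum_congr rfl fun _ _ => Finset.sum_congr rfl fun _ _ => by ring
    have h3 : Aᵀ * (∑ α, ∑ β, κ α β • ((C α).1ᵀ * G⁻¹ * (C β).1)) * A
        = -∑ l, ∑ m, (∑ α, ∑ β, κ α β * (E α l * E β m)) • ((D l).1 * (D m).1) := by
      simp only [Finset.mul_sum, Finset.sum_mul, Matrix.mul_smul, Matrix.smul_mul, h1, smul_neg,
        Finset.smul_sum, smul_smul, Finset.sum_smul, Finset.sum_neg_distrib]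
      congr 1
      calc _ = ∑ α, ∑ l, ∑ β, ∑ m, (κ α β * (E α l * E β m)) • ((D l).1 * (D m).1) :=
            Finset.sum_congr rfl fun α _ => Finset.sum_comm
        _ = ∑ l, ∑ α, ∑ m, ∑ β, (κ α β * (E α l * E β m)) • ((D l).1 * (D m).1) := by
            rw [Finset.sum_comm]
            exact Finset.sum_congr rfl fun l _ => Finset.sum_congr rfl fun α _ => Finset.sum_comm
        _ = _ := Finset.sum_congr rfl fun l _ => Finset.sum_comm
    rw [h3]
    simp [h2]
  constructor
  · rintro ⟨lam, h⟩
    refine ⟨-lam, ?_⟩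
    rw [hinj, key, Matrix.mul_smul, Matrix.smul_mul, hA] at h
    rw [neg_smul, ← h, neg_neg]
  · rintro ⟨c, h⟩
    refine ⟨-c, ?_⟩
    rw [hinj, key, Matrix.mul_smul, Matrix.smul_mul, hA, h, neg_smul]

end IsFrame

/-- Every left-invariant metric has an adapted orthonormal frame. -/
theorem exists_isFrame (C : SkewTuple q p) {B : Matrix (Fin q ⊕ Fin p) (Fin q ⊕ Fin p) ℝ}
    (hB : B.PosDef) : ∃ D F, IsFrame C B D F := by
  have hBt : Bᵀ = B := hB.isHermitian
  have hκ : B.toBlocks₂₂.PosDef := hB.submatrix Sum.inr_injective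
  have hH : Function.Injective (horLiftMatrix B).mulVec := by
    intro x y h
    have h' := congrArg (fun u : Nil q p => u.hor) h
    have e : ∀ x, Nil.hor (horLiftMatrix B *ᵥ x : Nil q p) = x := by
      intro x; rw [← horLift_eq]; rfl
    simpa [e] using h'
  have hG : ((horLiftMatrix B)ᵀ * B * horLiftMatrix B).PosDef := by
    have := hB.conjTranspose_mul_mul_same hH
    rwa [Matrix.conjTranspose_eq_transpose_of_trivial] at this
  obtain ⟨A, -, hA⟩ := exists_congr_one hG
  obtain ⟨E, hE, hEκ⟩ := exists_congr_one hκ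
  have hEd : IsUnit E.det := (Matrix.isUnit_iff_isUnit_det _).1 hE
  have hκd : IsUnit B.toBlocks₂₂.det := (Matrix.isUnit_iff_isUnit_det _).1 hκ.isUnit
  have hskew : ∀ l, ∑ k, E⁻¹ l k • (Aᵀ * (C k).1 * A) ∈ LieAlgebra.Orthogonal.so (Fin q) ℝ := by
    intro l
    refine Submodule.sum_mem _ fun k _ => Submodule.smul_mem _ _ ?_
    refine (LieAlgebra.Orthogonal.mem_so _ _ _).2 ?_
    simp [Matrix.transpose_mul, C.transpose_eq, Matrix.mul_assoc]
  -- the frame consists of the horizontal lifts of the columns of `A`, and the columns of `E` in `𝔷`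
  set V : Matrix (Fin q ⊕ Fin p) (Fin p) ℝ := Matrix.fromRows 0 E with hV
  set H := horLiftMatrix B with hHdef
  have hVB : Vᵀ * B = Eᵀ * Matrix.fromCols B.toBlocks₂₁ B.toBlocks₂₂ := by
    conv_lhs => rw [← Matrix.fromBlocks_toBlocks B]
    rw [hV, Matrix.transpose_fromRows, Matrix.fromCols_mul_fromBlocks, Matrix.mul_fromCols]
    simp
  have hVV : Vᵀ * B * V = 1 := by
    rw [hVB, hV, Matrix.mul_assoc, Matrix.fromCols_mul_fromRows, Matrix.mul_zero, zero_add,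
      ← Matrix.mul_assoc, hEκ]
  have hVH : Vᵀ * B * H = 0 := by
    rw [hVB, hHdef, horLiftMatrix, Matrix.mul_assoc, Matrix.fromCols_mul_fromRows, Matrix.mul_neg,
      ← Matrix.mul_assoc, Matrix.mul_nonsing_inv _ hκd]
    simp
  have hHV : Hᵀ * B * V = 0 := by
    have := congrArg Matrix.transpose hVH
    simpa [Matrix.transpose_mul, hBt, Matrix.mul_assoc] using this
  refine ⟨fun l => ⟨_, hskew l⟩, Matrix.fromCols (H * A) V, ?_, ?_, fun k => ?_⟩
  · rw [Matrix.transpose_fromCols, Matrix.fromRows_mul, Matrix.fromRows_mul, Matrix.mul_fromCols,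
      Matrix.mul_fromCols, Matrix.fromRows_fromCols_eq_fromBlocks, ← Matrix.fromBlocks_one,
      Matrix.fromBlocks_inj, Matrix.transpose_mul]
    refine ⟨?_, ?_, ?_, hVV⟩
    · rw [← hA]; simp only [Matrix.mul_assoc]
    · rw [Matrix.mul_assoc, Matrix.mul_assoc, ← Matrix.mul_assoc Hᵀ, hHV, Matrix.mul_zero]
    · rw [← Matrix.mul_assoc, hVH, Matrix.zero_mul]
  · ext i k
    simp [Matrix.toBlocks₁₂, hV]
  · have h1 : (Matrix.fromCols (H * A) V).toBlocks₁₁ = A := by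
      rw [hHdef, horLiftMatrix, Matrix.fromRows_mul]
      ext i j; simp [Matrix.toBlocks₁₁]
    have h2 : (Matrix.fromCols (H * A) V).toBlocks₂₂ = E := by
      ext i j; simp [Matrix.toBlocks₂₂, hV]
    rw [h1, h2]
    simp only [Finset.smul_sum, smul_smul]
    rw [Finset.sum_comm]
    simp_rw [← Finset.sum_smul, ← Matrix.mul_apply, Matrix.mul_nonsing_inv _ hEd, Matrix.one_apply]
    simp

/-! ### Minimal points of the action of `SL_q` -/

theorem momentSL_transpose (D : SkewTuple q p) : (momentSL D)ᵀ = momentSL D := by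
  simp [momentSL, momentGL, Matrix.transpose_sum, Matrix.transpose_mul, D.transpose_eq]

theorem trace_momentSL (D : SkewTuple q p) : (momentSL D).trace = 0 := by
  rcases Nat.eq_zero_or_pos q with rfl | hq
  · simp [Matrix.trace]
  · have : (q : ℝ) ≠ 0 := by positivity
    simp [momentSL, this]

theorem trace_momentSL_sq (D : SkewTuple q p) :
    (momentSL D * momentSL D).trace = -2 * ∑ k, (momentSL D * ((D k).1 * (D k).1)).trace := by
  have h : momentSL D * momentSL D
      = momentSL D * momentGL D - ((momentGL D).trace / (q : ℝ)) • momentSL D := by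
    conv_lhs => enter [2]; rw [momentSL]
    simp [Matrix.mul_sub]
  rw [h, Matrix.trace_sub, Matrix.trace_smul, trace_momentSL, momentGL]
  simp [Finset.mul_sum, Matrix.trace_sum]

/-- The sum in the hypothesis is `-½ tr (m²)`, because `m` is trace-free; since `m` is symmetric,
this is a multiple of its squared norm. -/
theorem momentSL_eq_zero_of_trace {D : SkewTuple q p}
    (h : ∑ k, (momentSL D * ((D k).1 * (D k).1)).trace = 0) : momentSL D = 0 := by
  have h1 := trace_momentSL_sq D
  rw [h, mul_zero] at h1
  refine Matrix.trace_conjTranspose_mul_self_eq_zero_iff.1 ?_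
  rwa [Matrix.conjTranspose_eq_transpose_of_trivial, momentSL_transpose]

theorem momentSL_eq_zero_iff {D : SkewTuple q p} :
    momentSL D = 0 ↔ ∃ c : ℝ, ∑ k, (D k).1 * (D k).1 = c • 1 := by
  constructor
  · intro h
    refine ⟨-1 / 2 * ((momentGL D).trace / (q : ℝ)), ?_⟩
    rw [momentSL, sub_eq_zero] at h
    rw [mul_smul, ← h, momentGL, smul_smul]
    norm_num
  · rintro ⟨c, hc⟩
    rcases Nat.eq_zero_or_pos q with rfl | hq
    · exact Subsingleton.elim _ _
    · have : (q : ℝ) ≠ 0 := by positivity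
      rw [momentSL, momentGL, hc]
      simp only [smul_smul, Matrix.trace_smul, Matrix.trace_one, Fintype.card_fin, smul_eq_mul,
        mul_div_cancel_right₀ _ this, sub_self]

/-- Minimal points are the tuples with vanishing moment map: if `m` annihilates `D`, it
anticommutes with each `D^k`, so that `tr (m (D^k)²) = 0`, and `tr (m²) = 0`. -/
theorem isSLMinimal_iff_momentSL {D : SkewTuple q p} : IsSLMinimal D ↔ momentSL D = 0 := by
  constructor
  · intro h
    refine momentSL_eq_zero_of_trace (Finset.sum_eq_zero fun k _ => ?_)
    have h1 := h k
    rw [momentSL_transpose] at h1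
    have h2 : (momentSL D * ((D k).1 * (D k).1)).trace
        = -(momentSL D * ((D k).1 * (D k).1)).trace := by
      conv_lhs => rw [← Matrix.mul_assoc, eq_neg_of_add_eq_zero_left h1, Matrix.neg_mul,
        Matrix.trace_neg, Matrix.mul_assoc, Matrix.trace_mul_comm, Matrix.mul_assoc]
    linarith
  · intro h k
    simp [h]

/-- The squared Frobenius norm of a tuple. -/
def normSq (D : SkewTuple q p) : ℝ := ∑ k, ∑ i, ∑ j, (D k).1 i j ^ 2

theorem continuous_entry (k : Fin p) (i j : Fin q) :
    Continuous fun D : SkewTuple q p => (D k).1 i j :=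
  (continuous_subtype_val.comp (continuous_apply k)).matrix_elem i j

theorem isClosed_so :
    IsClosed {M : Matrix (Fin q) (Fin q) ℝ | M ∈ LieAlgebra.Orthogonal.so (Fin q) ℝ} := by
  simp_rw [LieAlgebra.Orthogonal.mem_so]
  exact isClosed_eq continuous_id.matrix_transpose continuous_neg

theorem isCompact_normSq_le (R : ℝ) : IsCompact {D : SkewTuple q p | normSq D ≤ R} := by
  -- the tuples are a closed subspace of the space of all tuples of matrices, where the bound on
  -- the norm bounds each entry
  have hcl : Topology.IsClosedEmbedding (fun D : SkewTuple q p => fun k => (D k).1) :=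
    Topology.IsClosedEmbedding.piMap fun _ => isClosed_so.isClosedEmbedding_subtypeVal
  have hK : IsCompact (Set.pi Set.univ fun _ : Fin p => Set.pi Set.univ fun _ : Fin q =>
      Set.pi Set.univ fun _ : Fin q => Set.Icc (-(max R 0).sqrt) (max R 0).sqrt) :=
    isCompact_univ_pi fun _ => isCompact_univ_pi fun _ => isCompact_univ_pi fun _ => isCompact_Icc
  refine (hcl.isCompact_preimage hK).of_isClosed_subset ?_ ?_
  · refine isClosed_le ?_ continuous_const
    exact continuous_finsetSum _ fun k _ => continuous_finsetSum _ fun i _ =>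
      continuous_finsetSum _ fun j _ => (continuous_entry k i j).pow 2
  · intro D hD k _ i _ j _
    have h : (D k).1 i j ^ 2 ≤ R := by
      refine le_trans ?_ hD
      have h1 : (D k).1 i j ^ 2 ≤ ∑ j, (D k).1 i j ^ 2 :=
        Finset.single_le_sum (f := fun j => (D k).1 i j ^ 2) (fun _ _ => sq_nonneg _)
          (Finset.mem_univ j)
      have h2 : ∑ j, (D k).1 i j ^ 2 ≤ ∑ i, ∑ j, (D k).1 i j ^ 2 :=
        Finset.single_le_sum (f := fun i => ∑ j, (D k).1 i j ^ 2)
          (fun _ _ => Finset.sum_nonneg fun _ _ => sq_nonneg _) (Finset.mem_univ i)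
      have h3 : ∑ i, ∑ j, (D k).1 i j ^ 2 ≤ normSq D :=
        Finset.single_le_sum (f := fun k => ∑ i, ∑ j, (D k).1 i j ^ 2)
          (fun _ _ => Finset.sum_nonneg fun _ _ => Finset.sum_nonneg fun _ _ => sq_nonneg _)
          (Finset.mem_univ k)
      exact h1.trans (h2.trans h3)
    exact Set.mem_Icc.2 (abs_le.1 (Real.abs_le_sqrt (h.trans (le_max_left _ _))))

/-- A closed orbit contains a vector of minimal norm. -/
theorem exists_minimal_of_isClosed {C : SkewTuple q p} (h : IsClosed (slOrbit C)) :
    ∃ g₀, ∀ g, normSq (slAct g₀ C) ≤ normSq (slAct g C) := by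
  have hK := (isCompact_normSq_le (q := q) (p := p) (normSq (slAct 1 C))).inter_right h
  have hf : Continuous (normSq : SkewTuple q p → ℝ) :=
    continuous_finsetSum _ fun k _ => continuous_finsetSum _ fun i _ =>
      continuous_finsetSum _ fun j _ => (continuous_entry k i j).pow 2
  obtain ⟨D, ⟨hD, g₀, rfl⟩, hmin⟩ := hK.exists_isMinOn
    ⟨slAct 1 C, le_refl (normSq (slAct 1 C)), 1, rfl⟩ hf.continuousOn
  refine ⟨g₀, fun g => ?_⟩
  by_cases hg : normSq (slAct g C) ≤ normSq (slAct 1 C)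
  · exact hmin ⟨hg, g, rfl⟩
  · exact le_trans hD (le_of_not_ge hg)

theorem slAct_mul (g h : Matrix.SpecialLinearGroup (Fin q) ℝ) (C : SkewTuple q p) :
    slAct g (slAct h C) = slAct (g * h) C := by
  ext1 k
  refine Subtype.ext ?_
  simp [slAct, Matrix.transpose_mul, Matrix.mul_assoc]

/-- The derivative at `t = 0` of the squared norm of `(1 + t m) · D`, for symmetric `m`. -/
theorem hasDerivAt_normSq_one_add_smul (D : SkewTuple q p) {m : Matrix (Fin q) (Fin q) ℝ}
    (hm : mᵀ = m) :
    HasDerivAt (fun t : ℝ => ∑ k, ∑ i, ∑ j,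
        ((1 + t • m) * (D k).1 * (1 + t • m)ᵀ : Matrix (Fin q) (Fin q) ℝ) i j ^ 2)
      (-4 * ∑ k, (m * ((D k).1 * (D k).1)).trace) 0 := by
  have hexp : ∀ (t : ℝ) k i j, ((1 + t • m) * (D k).1 * (1 + t • m)ᵀ : Matrix (Fin q) (Fin q) ℝ) i j
      = (D k).1 i j + t * (m * (D k).1 + (D k).1 * m) i j + t ^ 2 * (m * (D k).1 * m) i j := by
    intro t k i j
    have : (1 + t • m) * (D k).1 * (1 + t • m)ᵀ
        = (D k).1 + t • (m * (D k).1 + (D k).1 * m) + t ^ 2 • (m * (D k).1 * m) := by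
      rw [Matrix.transpose_add, Matrix.transpose_one, Matrix.transpose_smul, hm]
      simp only [Matrix.add_mul, Matrix.mul_add, Matrix.one_mul, Matrix.mul_one, Matrix.smul_mul,
        Matrix.mul_smul, smul_smul, smul_add, Matrix.mul_assoc, sq]
      abel
    rw [this]
    simp [mul_add]
  have hval : -4 * ∑ k, (m * ((D k).1 * (D k).1)).trace
      = ∑ k, ∑ i, ∑ j, 2 * (D k).1 i j * (m * (D k).1 + (D k).1 * m) i j := by
    rw [Finset.mul_sum]
    refine Finset.sum_congr rfl fun k _ => ?_
    have h1 : ∑ i, ∑ j, 2 * (D k).1 i j * (m * (D k).1 + (D k).1 * m) i j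
        = 2 * ((D k).1 * (m * (D k).1 + (D k).1 * m)ᵀ).trace := by
      simp only [Matrix.trace, Matrix.diag_apply, Matrix.mul_apply, Finset.mul_sum, mul_assoc,
        Matrix.transpose_apply]
    have h2 : ((D k).1 * ((D k).1 * m)).trace = (m * ((D k).1 * (D k).1)).trace := by
      rw [← Matrix.mul_assoc, Matrix.trace_mul_comm]
    have h3 : ((D k).1 * (m * (D k).1)).trace = (m * ((D k).1 * (D k).1)).trace := by
      rw [Matrix.trace_mul_comm, Matrix.mul_assoc]
    rw [h1, Matrix.transpose_add, Matrix.transpose_mul, Matrix.transpose_mul, hm, D.transpose_eq]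
    simp only [Matrix.mul_add, Matrix.neg_mul, Matrix.mul_neg, Matrix.trace_add, Matrix.trace_neg,
      h2, h3]
    ring
  rw [hval]
  simp_rw [hexp]
  refine HasDerivAt.fun_sum fun k _ => HasDerivAt.fun_sum fun i _ => HasDerivAt.fun_sum
    fun j _ => ?_
  have h := (((hasDerivAt_id (0 : ℝ)).mul_const ((m * (D k).1 + (D k).1 * m) i j)).const_add
    ((D k).1 i j)).add (((hasDerivAt_id (0 : ℝ)).pow 2).mul_const ((m * (D k).1 * m) i j))
  convert! h.pow 2 using 1
  simp

/-- A vector of minimal norm in its orbit has vanishing moment map: the norm is stationary along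
`t ↦ det (1 + t m) ^ (-1 / q) (1 + t m)`, where `m` is the moment map. -/
theorem momentSL_eq_zero_of_minimal {D : SkewTuple q p}
    (h : ∀ g, normSq D ≤ normSq (slAct g D)) : momentSL D = 0 := by
  rcases Nat.eq_zero_or_pos q with rfl | hq
  · exact Subsingleton.elim _ _
  have hq' : (q : ℝ) ≠ 0 := by positivity
  set m := momentSL D with hm
  have hmt : mᵀ = m := momentSL_transpose D
  have hN := hasDerivAt_normSq_one_add_smul D hmt
  set N : ℝ → ℝ := fun t => ∑ k, ∑ i, ∑ j,
    ((1 + t • m) * (D k).1 * (1 + t • m)ᵀ : Matrix (Fin q) (Fin q) ℝ) i j ^ 2 with hNdef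
  set d : ℝ → ℝ := fun t => (1 + t • m).det with hd
  have hd0 : d 0 = 1 := by simp [hd]
  -- the determinant is stationary since `m` is trace-free
  have hdd : HasDerivAt d 0 0 := by
    obtain ⟨P, hP⟩ : ∃ P : Polynomial ℝ, ∀ t, d t = 1 + m.trace * t + P.eval t * t ^ 2 :=
      ⟨_, fun t => Matrix.det_one_add_smul t m⟩
    rw [funext hP]
    have h1 := (((hasDerivAt_id (0 : ℝ)).const_mul m.trace).const_add 1).add
      ((P.hasDerivAt 0).mul ((hasDerivAt_id (0 : ℝ)).pow 2))
    convert! h1 using 1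
    simp [hm, trace_momentSL]
  have hs : HasDerivAt (fun t => (d t ^ (-1 / q : ℝ)) ^ 4) 0 0 := by
    have h1 := hdd.rpow_const (p := (-1 / q : ℝ)) (Or.inl (by rw [hd0]; exact one_ne_zero))
    convert! h1.pow 4 using 1
    simp
  have hφ := hs.mul hN
  have hmin : IsLocalMin (fun t => (d t ^ (-1 / q : ℝ)) ^ 4 * N t) 0 := by
    have hpos : ∀ᶠ t in nhds (0 : ℝ), 0 < d t :=
      hdd.continuousAt.eventually (lt_mem_nhds (by rw [hd0]; exact one_pos))
    filter_upwards [hpos] with t ht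
    -- the factor `s` rescales `1 + t m` to determinant one
    set s := d t ^ (-1 / q : ℝ) with hsdef
    have hdet : (s • (1 + t • m)).det = 1 := by
      rw [Matrix.det_smul, Fintype.card_fin]
      change s ^ q * d t = 1
      rw [hsdef, ← Real.rpow_natCast, ← Real.rpow_mul ht.le, div_mul_cancel₀ _ hq',
        Real.rpow_neg_one, inv_mul_cancel₀ ht.ne']
    have h1 := h ⟨s • (1 + t • m), hdet⟩
    have h2 : normSq (slAct ⟨s • (1 + t • m), hdet⟩ D) = s ^ 4 * N t := by
      simp only [normSq, slAct, hNdef, Finset.mul_sum]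
      refine Finset.sum_congr rfl fun k _ => Finset.sum_congr rfl fun i _ =>
        Finset.sum_congr rfl fun j _ => ?_
      rw [Matrix.transpose_smul, Matrix.smul_mul, Matrix.smul_mul, Matrix.mul_smul, smul_smul,
        Matrix.smul_apply, smul_eq_mul]
      ring
    have h3 : (d 0 ^ (-1 / q : ℝ)) ^ 4 * N 0 = normSq D := by
      simp [hd0, hNdef, normSq]
    change (d 0 ^ (-1 / q : ℝ)) ^ 4 * N 0 ≤ s ^ 4 * N t
    rw [h3, ← h2]
    exact h1
  have h0 := hmin.hasDerivAt_eq_zero hφ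
  refine momentSL_eq_zero_of_trace ?_
  simpa [hd0] using h0

/-- A closed orbit of `SL_q` yields a trivial Ricci Yang–Mills soliton: if `g · C` is minimal, the
columns of `gᵗ` and a basis of the centre are declared to be orthonormal. -/
theorem exists_isTrivialRYMSoliton_of_isClosed {C : SkewTuple q p} (h : IsClosed (slOrbit C)) :
    ∃ B : Matrix (Fin q ⊕ Fin p) (Fin q ⊕ Fin p) ℝ, B.PosDef ∧ IsTrivialRYMSoliton C B := by
  obtain ⟨g, hg⟩ := exists_minimal_of_isClosed h
  have hm : momentSL (slAct g C) = 0 :=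
    momentSL_eq_zero_of_minimal fun g' => by rw [slAct_mul]; exact hg _
  set F : Matrix (Fin q ⊕ Fin p) (Fin q ⊕ Fin p) ℝ := Matrix.fromBlocks (g.1)ᵀ 0 0 1 with hFdef
  have hF : IsUnit F.det := by simp [hFdef]
  have hFt : IsUnit (Fᵀ).det := by rwa [Matrix.det_transpose]
  refine ⟨(F⁻¹)ᵀ * F⁻¹, ?_, ?_⟩
  · have := Matrix.PosDef.conjTranspose_mul_self (F⁻¹)
      (Matrix.mulVec_injective_of_isUnit ((Matrix.isUnit_nonsing_inv_iff).2
        ((Matrix.isUnit_iff_isUnit_det _).2 hF)))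
    rwa [Matrix.conjTranspose_eq_transpose_of_trivial] at this
  · have hfr : IsFrame C ((F⁻¹)ᵀ * F⁻¹) (slAct g C) F := by
      refine ⟨?_, by simp [hFdef], fun k => ?_⟩
      · rw [Matrix.transpose_nonsing_inv, ← Matrix.mul_assoc, Matrix.mul_nonsing_inv _ hFt,
          Matrix.one_mul, Matrix.nonsing_inv_mul _ hF]
      · simp [hFdef, slAct, Matrix.one_apply]
    rw [hfr.isTrivialRYMSoliton_iff, ← momentSL_eq_zero_iff]
    exact hm

/-! ### Transport of the Ricci tensor to an orthonormal frame -/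

/-- The functional `w ↦ 2⟨∇_u v, w⟩` of the Koszul formula. -/
def koszul (C : SkewTuple q p) (B : Matrix (Fin q ⊕ Fin p) (Fin q ⊕ Fin p) ℝ) (u v : Nil q p) :
    Nil q p →ₗ[ℝ] ℝ :=
  Matrix.toLinearMap₂' ℝ B (bracket C u v)
    - (Matrix.toLinearMap₂' ℝ B).flip u ∘ₗ bracketLin C v
    + (Matrix.toLinearMap₂' ℝ B).flip v ∘ₗ (bracketLin C).flip u

theorem koszul_apply (C : SkewTuple q p) (B : Matrix (Fin q ⊕ Fin p) (Fin q ⊕ Fin p) ℝ)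
    (u v w : Nil q p) : koszul C B u v w
      = ip B (bracket C u v) w - ip B (bracket C v w) u + ip B (bracket C w u) v := by
  simp [koszul, Matrix.toLinearMap₂'_apply', ip]

theorem leviCivita_eq (C : SkewTuple q p) (B : Matrix (Fin q ⊕ Fin p) (Fin q ⊕ Fin p) ℝ)
    (u v : Nil q p) : leviCivita C B u v
      = (1 / 2 : ℝ) • (B⁻¹ *ᵥ fun s => koszul C B u v (Pi.single s 1)) := by
  simp only [leviCivita, koszul_apply]

theorem koszul_single (C : SkewTuple q p) (B : Matrix (Fin q ⊕ Fin p) (Fin q ⊕ Fin p) ℝ)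
    (u v : Nil q p) (s : Fin q ⊕ Fin p) : koszul C B u v (Pi.single s 1)
      = Matrix.toLinearMap₂' ℝ B (bracketLin C u v) (Pi.single s 1 : Nil q p)
        - Matrix.toLinearMap₂' ℝ B (bracketLin C v (Pi.single s 1)) u
        + Matrix.toLinearMap₂' ℝ B (bracketLin C (Pi.single s 1) u) v := by
  rw [koszul_apply]
  simp only [bracketLin_apply, ip, Matrix.toLinearMap₂'_apply']

/-- The Levi-Civita connection as a bilinear map on the Lie algebra. -/
def leviCivitaLin (C : SkewTuple q p) (B : Matrix (Fin q ⊕ Fin p) (Fin q ⊕ Fin p) ℝ) :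
    Nil q p →ₗ[ℝ] Nil q p →ₗ[ℝ] Nil q p :=
  LinearMap.mk₂ ℝ (leviCivita C B)
    (fun u u' v => by
      rw [leviCivita_eq, leviCivita_eq, leviCivita_eq, ← smul_add, ← Matrix.mulVec_add]
      congr 2
      ext s
      simp only [koszul_single, map_add, LinearMap.add_apply, Pi.add_apply]
      ring)
    (fun c u v => by
      rw [leviCivita_eq, leviCivita_eq, smul_comm c, ← Matrix.mulVec_smul _ c]
      congr 2
      ext s
      simp only [koszul_single, map_smul, LinearMap.smul_apply, Pi.smul_apply, smul_eq_mul]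
      ring)
    (fun u v v' => by
      rw [leviCivita_eq, leviCivita_eq, leviCivita_eq, ← smul_add, ← Matrix.mulVec_add]
      congr 2
      ext s
      simp only [koszul_single, map_add, LinearMap.add_apply, Pi.add_apply]
      ring)
    (fun c u v => by
      rw [leviCivita_eq, leviCivita_eq, smul_comm c, ← Matrix.mulVec_smul _ c]
      congr 2
      ext s
      simp only [koszul_single, map_smul, LinearMap.smul_apply, Pi.smul_apply, smul_eq_mul]
      ring)

@[simp] theorem leviCivitaLin_apply (C : SkewTuple q p)
    (B : Matrix (Fin q ⊕ Fin p) (Fin q ⊕ Fin p) ℝ) (u v : Nil q p) :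
    leviCivitaLin C B u v = leviCivita C B u v := rfl

/-- The matrix of the endomorphism `u ↦ R(u, v)w`, whose trace is `Ric(v, w)`. -/
def riemannMatrix (C : SkewTuple q p) (B : Matrix (Fin q ⊕ Fin p) (Fin q ⊕ Fin p) ℝ)
    (v w : Nil q p) : Matrix (Fin q ⊕ Fin p) (Fin q ⊕ Fin p) ℝ :=
  LinearMap.toMatrix' ((leviCivitaLin C B).flip (leviCivita C B v w)
    - leviCivitaLin C B v ∘ₗ (leviCivitaLin C B).flip w
    - (leviCivitaLin C B).flip w ∘ₗ (bracketLin C).flip v)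

theorem riemannMatrix_mulVec (C : SkewTuple q p) (B : Matrix (Fin q ⊕ Fin p) (Fin q ⊕ Fin p) ℝ)
    (u v w : Nil q p) : riemannMatrix C B v w *ᵥ u = riemann C B u v w := by
  rw [riemannMatrix, LinearMap.toMatrix'_mulVec]
  simp [riemann]

theorem ricciNil_eq_trace (C : SkewTuple q p) (B : Matrix (Fin q ⊕ Fin p) (Fin q ⊕ Fin p) ℝ)
    (v w : Nil q p) : ricciNil C B v w = (riemannMatrix C B v w).trace := by
  rw [ricciNil, Matrix.trace]
  refine Finset.sum_congr rfl fun s _ => ?_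
  rw [← riemannMatrix_mulVec, Matrix.mulVec_single_one, Matrix.col_apply, Matrix.diag_apply]

namespace IsFrame

variable {C D : SkewTuple q p} {B F : Matrix (Fin q ⊕ Fin p) (Fin q ⊕ Fin p) ℝ}

theorem isUnit_det (hF : IsFrame C B D F) : IsUnit F.det :=
  Matrix.isUnit_det_of_left_inverse hF.orthonormal

theorem ip_mulVec (hF : IsFrame C B D F) (a b : Nil q p) : ip B (F *ᵥ a) (F *ᵥ b) = ip 1 a b := by
  rw [RYM.ip_mulVec, hF.orthonormal, ip]

theorem bracket_mulVec (hF : IsFrame C B D F) (a b : Nil q p) :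
    bracket C (F *ᵥ a) (F *ᵥ b) = F *ᵥ bracket D a b := by
  have hh : ∀ a : Nil q p, Nil.hor (F *ᵥ a : Nil q p) = F.toBlocks₁₁ *ᵥ a.hor := by
    intro a
    ext i
    have h0 : ∀ l, F (Sum.inl i) (Sum.inr l) = 0 := fun l => congrFun (congrFun hF.vertical i) l
    simp [Nil.hor, Matrix.mulVec, dotProduct, h0, Matrix.toBlocks₁₁]
  ext s
  rcases s with i | k
  · have h0 : ∀ l, F (Sum.inl i) (Sum.inr l) = 0 := fun l => congrFun (congrFun hF.vertical i) l
    simp [bracket, Matrix.mulVec, dotProduct, h0]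
  · have h1 : bracket C (F *ᵥ a) (F *ᵥ b) (Sum.inr k)
        = a.hor ⬝ᵥ ((F.toBlocks₁₁ᵀ * (C k).1 * F.toBlocks₁₁) *ᵥ b.hor) := by
      simp only [bracket, Sum.elim_inr, hh]
      rw [← Matrix.mulVec_mulVec, ← Matrix.mulVec_mulVec, Matrix.dotProduct_mulVec a.hor,
        Matrix.vecMul_transpose]
    rw [h1, hF.structure_eq, Matrix.sum_mulVec, dotProduct_sum]
    simp [bracket, Matrix.mulVec, dotProduct, Matrix.toBlocks₂₂,
      Finset.mul_sum, mul_assoc, mul_left_comm]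

theorem inv_eq (hF : IsFrame C B D F) : B⁻¹ = F * Fᵀ := by
  apply Matrix.inv_eq_left_inv
  rw [Matrix.mul_assoc]
  exact mul_eq_one_comm.1 hF.orthonormal

/-- A frame is an isometric isomorphism of Lie algebras, so it preserves the connection. -/
theorem leviCivita_mulVec (hF : IsFrame C B D F) (a b : Nil q p) :
    leviCivita C B (F *ᵥ a) (F *ᵥ b) = F *ᵥ leviCivita D 1 a b := by
  have hk : ∀ t, koszul C B (F *ᵥ a) (F *ᵥ b) (F *ᵥ Pi.single t 1)
      = koszul D 1 a b (Pi.single t 1) := by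
    intro t
    simp only [koszul_apply, hF.bracket_mulVec, hF.ip_mulVec]
  rw [leviCivita_eq, leviCivita_eq, hF.inv_eq, Matrix.mulVec_smul, ← Matrix.mulVec_mulVec, inv_one,
    Matrix.one_mulVec]
  congr 2
  ext t
  rw [← hk, LinearMap.pi_apply_eq_sum_univ (koszul C B (F *ᵥ a) (F *ᵥ b)) (F *ᵥ Pi.single t 1)]
  simp only [Matrix.mulVec, dotProduct, Matrix.transpose_apply]
  refine Finset.sum_congr rfl fun s _ => ?_
  have e : (fun j => if s = j then (1 : ℝ) else 0) = Pi.single s 1 := by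
    ext j; simp [Pi.single_apply, eq_comm]
  rw [e]
  simp [Pi.single_apply]

theorem riemann_mulVec (hF : IsFrame C B D F) (a b c : Nil q p) :
    riemann C B (F *ᵥ a) (F *ᵥ b) (F *ᵥ c) = F *ᵥ riemann D 1 a b c := by
  simp only [riemann, hF.leviCivita_mulVec, hF.bracket_mulVec, Matrix.mulVec_sub]

theorem ricciNil_mulVec (hF : IsFrame C B D F) (a b : Nil q p) :
    ricciNil C B (F *ᵥ a) (F *ᵥ b) = ricciNil D 1 a b := by
  have h : riemannMatrix C B (F *ᵥ a) (F *ᵥ b) * F = F * riemannMatrix D 1 a b := by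
    refine Matrix.ext_of_mulVec_single fun s => ?_
    rw [← Matrix.mulVec_mulVec, ← Matrix.mulVec_mulVec, riemannMatrix_mulVec, riemannMatrix_mulVec,
      hF.riemann_mulVec]
  have h2 : riemannMatrix C B (F *ᵥ a) (F *ᵥ b) = F * riemannMatrix D 1 a b * F⁻¹ := by
    rw [← h, Matrix.mul_assoc, Matrix.mul_nonsing_inv _ hF.isUnit_det, Matrix.mul_one]
  rw [ricciNil_eq_trace, ricciNil_eq_trace, h2, Matrix.trace_mul_comm, ← Matrix.mul_assoc,
    Matrix.nonsing_inv_mul _ hF.isUnit_det, Matrix.one_mul]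

end IsFrame

/-! ### The Ricci tensor in an orthonormal frame -/

/-- The skew-symmetric matrix `J_z = ∑ z_k D^k`. -/
def jMatrix (D : SkewTuple q p) (z : Fin p → ℝ) : Matrix (Fin q) (Fin q) ℝ := ∑ k, z k • (D k).1

@[simp] theorem jMatrix_zero (D : SkewTuple q p) : jMatrix D 0 = 0 := by simp [jMatrix]

@[simp] theorem jMatrix_single (D : SkewTuple q p) (k : Fin p) :
    jMatrix D (Pi.single k 1) = (D k).1 := by
  simp [jMatrix, Pi.single_apply, ite_smul]

theorem jMatrix_smul (D : SkewTuple q p) (c : ℝ) (z : Fin p → ℝ) :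
    jMatrix D (c • z) = c • jMatrix D z := by
  simp [jMatrix, Finset.smul_sum, smul_smul]

theorem jMatrix_mulVec_apply (D : SkewTuple q p) (z : Fin p → ℝ) (x : Fin q → ℝ) (i : Fin q) :
    (jMatrix D z *ᵥ x) i = ∑ k, z k * ((D k).1 *ᵥ x) i := by
  simp [jMatrix, Matrix.sum_mulVec, Matrix.smul_mulVec]

theorem Nil.hor_single_inl (i : Fin q) :
    Nil.hor (Pi.single (Sum.inl i) 1 : Nil q p) = Pi.single i 1 := by
  ext j; simp [Nil.hor, Pi.single_apply]

theorem Nil.ver_single_inl (i : Fin q) : Nil.ver (Pi.single (Sum.inl i) 1 : Nil q p) = 0 := by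
  ext j; simp [Nil.ver]

theorem Nil.hor_single_inr (k : Fin p) : Nil.hor (Pi.single (Sum.inr k) 1 : Nil q p) = 0 := by
  ext j; simp [Nil.hor]

theorem Nil.ver_single_inr (k : Fin p) :
    Nil.ver (Pi.single (Sum.inr k) 1 : Nil q p) = Pi.single k 1 := by
  ext j; simp [Nil.ver, Pi.single_apply]

theorem Nil.hor_elim (x : Fin q → ℝ) (z : Fin p → ℝ) : Nil.hor (Sum.elim x z : Nil q p) = x := rfl

theorem Nil.ver_elim (x : Fin q → ℝ) (z : Fin p → ℝ) : Nil.ver (Sum.elim x z : Nil q p) = z := rfl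

theorem leviCivita_one (D : SkewTuple q p) (u v : Nil q p) :
    leviCivita D 1 u v = Sum.elim
      ((1 / 2 : ℝ) • (jMatrix D u.ver *ᵥ v.hor + jMatrix D v.ver *ᵥ u.hor))
      ((1 / 2 : ℝ) • fun k => u.hor ⬝ᵥ ((D k).1 *ᵥ v.hor)) := by
  have hbr : ∀ a b c : Nil q p, ip 1 (bracket D a b) c
      = ∑ k, (a.hor ⬝ᵥ ((D k).1 *ᵥ b.hor)) * c.ver k := by
    intro a b c
    simp [ip, dotProduct, bracket, Nil.ver]
  rw [leviCivita, inv_one, Matrix.one_mulVec]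
  ext s
  rcases s with i | k
  · simp only [hbr, Nil.hor_single_inl, Nil.ver_single_inl, Pi.smul_apply, Sum.elim_inl,
      Pi.add_apply, jMatrix_mulVec_apply]
    have h : ∀ k, v.hor ⬝ᵥ ((D k).1 *ᵥ Pi.single i 1) = -((D k).1 *ᵥ v.hor) i := by
      intro k; rw [D.dotProduct_mulVec_swap, single_one_dotProduct]
    simp only [h, single_one_dotProduct]
    simp [mul_comm]
  · simp [hbr, Nil.hor_single_inr, Nil.ver_single_inr, Pi.single_apply]

theorem leviCivita_one_self (D : SkewTuple q p) (v : Nil q p) :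
    leviCivita D 1 v v = Sum.elim (jMatrix D v.ver *ᵥ v.hor) 0 := by
  have hself : ∀ k x, x ⬝ᵥ ((D k).1 *ᵥ x) = 0 := by
    intro k x
    have := D.dotProduct_mulVec_swap k x x
    linarith
  rw [leviCivita_one]
  ext s
  rcases s with i | k
  · simp; ring
  · simp [hself]

/-- The Ricci tensor of a 2-step nilpotent metric Lie algebra:
`Ric(v, v) = -¼ tr (J_z²) - ½ ∑ |D^k x|²` for `v = (x, z)`. -/
theorem ricciNil_one (D : SkewTuple q p) (v : Nil q p) :
    ricciNil D 1 v v = -(1 / 4) * (jMatrix D v.ver * jMatrix D v.ver).trace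
      - 1 / 2 * ∑ k, ((D k).1 *ᵥ v.hor) ⬝ᵥ ((D k).1 *ᵥ v.hor) := by
  have hinl : ∀ i, riemann D 1 (Pi.single (Sum.inl i) 1) v v (Sum.inl i)
      = -(1 / 4) * (jMatrix D v.ver * jMatrix D v.ver) i i
        - 3 / 4 * ∑ k, ((D k).1 *ᵥ v.hor) i * ((D k).1 *ᵥ v.hor) i := by
    intro i
    have h1 : (jMatrix D v.ver *ᵥ (jMatrix D v.ver *ᵥ Pi.single i 1)) i
        = (jMatrix D v.ver * jMatrix D v.ver) i i := by
      rw [Matrix.mulVec_mulVec, Matrix.mulVec_single_one, Matrix.col_apply]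
    have h2 : (jMatrix D (fun k => ((D k).1 *ᵥ v.hor) i) *ᵥ v.hor) i
        = ∑ k, ((D k).1 *ᵥ v.hor) i * ((D k).1 *ᵥ v.hor) i := jMatrix_mulVec_apply _ _ _ _
    rw [riemann, leviCivita_one_self]
    simp only [leviCivita_one, bracket, Nil.hor_elim, Nil.ver_elim, Nil.hor_single_inl,
      Nil.ver_single_inl, Pi.sub_apply, Sum.elim_inl, jMatrix_zero, jMatrix_smul,
      Matrix.zero_mulVec, Matrix.mulVec_zero, Matrix.mulVec_smul, Matrix.smul_mulVec, zero_add,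
      add_zero, Pi.smul_apply, Pi.add_apply, Pi.zero_apply, smul_eq_mul, single_one_dotProduct, h1,
      h2, mul_zero]
    ring
  have hinr : ∀ k, riemann D 1 (Pi.single (Sum.inr k) 1) v v (Sum.inr k)
      = 1 / 4 * (((D k).1 *ᵥ v.hor) ⬝ᵥ ((D k).1 *ᵥ v.hor)) := by
    intro k
    have h1 : v.hor ⬝ᵥ ((D k).1 *ᵥ ((D k).1 *ᵥ v.hor))
        = -(((D k).1 *ᵥ v.hor) ⬝ᵥ ((D k).1 *ᵥ v.hor)) := D.dotProduct_mulVec_swap k _ _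
    rw [riemann, leviCivita_one_self]
    simp only [leviCivita_one, bracket, Nil.hor_elim, Nil.ver_elim, Nil.hor_single_inr,
      Nil.ver_single_inr, Pi.sub_apply, Sum.elim_inr, jMatrix_single, Matrix.mulVec_zero,
      Matrix.mulVec_smul, add_zero, Pi.smul_apply, smul_eq_mul, zero_dotProduct, dotProduct_smul,
      h1, mul_zero]
    ring
  rw [ricciNil, Fintype.sum_sum_type]
  simp only [hinl, hinr]
  rw [Finset.sum_sub_distrib, ← Finset.mul_sum, ← Finset.mul_sum, ← Finset.mul_sum, Finset.sum_comm]
  simp only [Matrix.trace, Matrix.diag_apply, dotProduct]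
  ring

/-! ### Invariance of the Ricci tensor under the geodesic flow -/

/-- The symmetric matrix `∑ (D^k)²`. -/
def sqSum (D : SkewTuple q p) : Matrix (Fin q) (Fin q) ℝ := ∑ k, (D k).1 * (D k).1

theorem sqSum_transpose (D : SkewTuple q p) : (sqSum D)ᵀ = sqSum D := by
  simp [sqSum, Matrix.transpose_sum, Matrix.transpose_mul, D.transpose_eq]

/-- The Gram matrix of the Ricci tensor in an orthonormal frame. -/
def ricciMatrix (D : SkewTuple q p) : Matrix (Fin q ⊕ Fin p) (Fin q ⊕ Fin p) ℝ :=
  Matrix.fromBlocks ((1 / 2 : ℝ) • sqSum D) 0 0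
    ((-(1 / 4) : ℝ) • Matrix.of fun k l => ((D k).1 * (D l).1).trace)

theorem ip_ricciMatrix (D : SkewTuple q p) (u v : Nil q p) :
    ip (ricciMatrix D) u v = 1 / 2 * (u.hor ⬝ᵥ (sqSum D *ᵥ v.hor))
      - 1 / 4 * (jMatrix D u.ver * jMatrix D v.ver).trace := by
  have hu : u = Sum.elim u.hor u.ver := by ext (i | k) <;> rfl
  have hv : v = Sum.elim v.hor v.ver := by ext (i | k) <;> rfl
  have h : (jMatrix D u.ver * jMatrix D v.ver).trace
      = u.ver ⬝ᵥ ((Matrix.of fun k l => ((D k).1 * (D l).1).trace) *ᵥ v.ver) := by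
    simp only [jMatrix, Finset.sum_mul, Finset.mul_sum, Matrix.trace_sum, dotProduct,
      Matrix.mulVec, Matrix.of_apply, smul_mul_smul_comm, Matrix.trace_smul, smul_eq_mul]
    rw [Finset.sum_comm]
    exact Finset.sum_congr rfl fun k _ => Finset.sum_congr rfl fun l _ => by ring
  rw [ip, ricciMatrix, h]
  conv_lhs => rw [hu, hv]
  rw [Matrix.fromBlocks_mulVec, sumElim_dotProduct_sumElim]
  simp only [Sum.elim_comp_inl, Sum.elim_comp_inr, Matrix.zero_mulVec, add_zero, zero_add,
    Matrix.smul_mulVec, dotProduct_smul, smul_eq_mul]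
  ring

theorem ricciNil_one_eq_ip (D : SkewTuple q p) (v : Nil q p) :
    ricciNil D 1 v v = ip (ricciMatrix D) v v := by
  have h : ∑ k, ((D k).1 *ᵥ v.hor) ⬝ᵥ ((D k).1 *ᵥ v.hor) = -(v.hor ⬝ᵥ (sqSum D *ᵥ v.hor)) := by
    rw [sqSum, Matrix.sum_mulVec, dotProduct_sum, ← Finset.sum_neg_distrib]
    refine Finset.sum_congr rfl fun k _ => ?_
    rw [← Matrix.mulVec_mulVec, D.dotProduct_mulVec_swap]
  rw [ricciNil_one, ip_ricciMatrix, h]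
  ring

/-- Along a curve with `w' = -∇_w w`, the derivative of `Ric(w, w)` is `-⟨J_z x, S x⟩`, where
`w = (x, z)` and `S = ∑ (D^k)²`. -/
theorem hasDerivAt_ricciNil (D : SkewTuple q p) {w : ℝ → Nil q p} {t : ℝ}
    (hw : HasDerivAt w (-leviCivita D 1 (w t) (w t)) t) :
    HasDerivAt (fun s => ricciNil D 1 (w s) (w s))
      (-((jMatrix D (w t).ver *ᵥ (w t).hor) ⬝ᵥ (sqSum D *ᵥ (w t).hor))) t := by
  have h := (Matrix.toLinearMap₂' ℝ (ricciMatrix D)).toContinuousBilinearMap.hasDerivAt_of_bilinear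
    (fun _ => hw) (fun _ => hw)
  have e : ∀ u v, (Matrix.toLinearMap₂' ℝ (ricciMatrix D)).toContinuousBilinearMap u v
      = ip (ricciMatrix D) u v := fun u v => Matrix.toLinearMap₂'_apply' _ _ _
  simp only [e, ← ricciNil_one_eq_ip] at h
  convert! h using 1
  have h1 : ∀ x : Fin q → ℝ, Nil.hor (-(Sum.elim x 0 : Nil q p)) = -x := fun x => rfl
  have h2 : ∀ x : Fin q → ℝ, Nil.ver (-(Sum.elim x 0 : Nil q p)) = 0 := by
    intro x; ext k; simp [Nil.ver]
  have h3 : ∀ x y : Fin q → ℝ, x ⬝ᵥ (sqSum D *ᵥ y) = y ⬝ᵥ (sqSum D *ᵥ x) := by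
    intro x y
    rw [Matrix.dotProduct_mulVec, ← Matrix.mulVec_transpose, sqSum_transpose, dotProduct_comm]
  rw [leviCivita_one_self, ip_ricciMatrix, ip_ricciMatrix, h1, h2, h3 (w t).hor]
  simp
  ring

/-- The vector field of the geodesic equation is quadratic, hence smooth: `b` is the bracket and `c`
the connection. -/
theorem contDiff_quadraticField {E : Type*} [NormedAddCommGroup E] [NormedSpace ℝ E]
    (b c : E →L[ℝ] E →L[ℝ] E) :
    ContDiff ℝ 1 fun y : E × E => (y.2 + (1 / 2 : ℝ) • b y.1 y.2, -c y.2 y.2) :=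
  (contDiff_snd.add (b.isBoundedBilinearMap.contDiff.const_smul (1 / 2 : ℝ))).prodMk
    (c.isBoundedBilinearMap.contDiff.comp (contDiff_snd.prodMk contDiff_snd)).neg

/-- Every vector is the initial velocity of a geodesic, in left-trivialised form. -/
theorem exists_isGeodesicOn (C : SkewTuple q p) (B : Matrix (Fin q ⊕ Fin p) (Fin q ⊕ Fin p) ℝ)
    (v₀ : Nil q p) : ∃ γ v : ℝ → Nil q p, ∃ ε > 0, v 0 = v₀ ∧ IsGeodesicOn C B γ v (-ε) ε := by
  -- the geodesic equation, as a first order system for the curve and its velocity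
  have hΦ := contDiff_quadraticField (bracketLin C).toContinuousBilinearMap
    (leviCivitaLin C B).toContinuousBilinearMap
  obtain ⟨α, hα0, ε, hε, hα⟩ := (hΦ.contDiffAt
    (x := (0, v₀))).exists_forall_mem_closedBall_exists_eq_forall_mem_Ioo_hasDerivAt₀ 0
  refine ⟨fun t => (α t).1, fun t => (α t).2, ε, hε, by simp [hα0], fun t ht => ?_⟩
  have hd := hα t (by simpa using ht)
  have hγ : HasDerivAt (fun t => (α t).1) ((α t).2 + (1 / 2 : ℝ) • bracket C (α t).1 (α t).2) t :=
    hd.fst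
  refine ⟨hγ.differentiableAt, ?_, hd.snd⟩
  have hb : bracket C (α t).1 (bracket C (α t).1 (α t).2) = 0 := by
    ext (i | k)
    · rfl
    · change (α t).1.hor ⬝ᵥ ((C k).1 *ᵥ (bracket C (α t).1 (α t).2).hor) = 0
      rw [bracket_hor, Matrix.mulVec_zero, dotProduct_zero]
  rw [hγ.deriv, maurerCartan_eq]
  change (α t).2 = _ - (1 / 2 : ℝ) • bracketLin C (α t).1 _
  rw [map_add, map_smul, bracketLin_apply, bracketLin_apply, hb]
  simp

namespace IsFrame

variable {C D : SkewTuple q p} {B F : Matrix (Fin q ⊕ Fin p) (Fin q ⊕ Fin p) ℝ}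

theorem hasDerivAt_ricciNil (hF : IsFrame C B D F) {v : ℝ → Nil q p} {t : ℝ}
    (hv : HasDerivAt v (-leviCivita C B (v t) (v t)) t) :
    HasDerivAt (fun s => ricciNil C B (v s) (v s))
      (-((jMatrix D (Nil.ver (F⁻¹ *ᵥ v t : Nil q p)) *ᵥ Nil.hor (F⁻¹ *ᵥ v t : Nil q p))
        ⬝ᵥ (sqSum D *ᵥ Nil.hor (F⁻¹ *ᵥ v t : Nil q p)))) t := by
  have hFv : ∀ u : Nil q p, F *ᵥ (F⁻¹ *ᵥ u) = u := by
    intro u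
    rw [Matrix.mulVec_mulVec, Matrix.mul_nonsing_inv _ hF.isUnit_det, Matrix.one_mulVec]
  have hw : HasDerivAt (fun s => (F⁻¹ *ᵥ v s : Nil q p))
      (-leviCivita D 1 (F⁻¹ *ᵥ v t) (F⁻¹ *ᵥ v t)) t := by
    have h := (LinearMap.toContinuousLinearMap (Matrix.mulVecLin F⁻¹)).hasFDerivAt.comp_hasDerivAt
      t hv
    convert! h using 1
    simp only [LinearMap.coe_toContinuousLinearMap', Matrix.mulVecLin_apply]
    conv_rhs => rw [← hFv (v t), hF.leviCivita_mulVec, Matrix.mulVec_neg, Matrix.mulVec_mulVec,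
      Matrix.nonsing_inv_mul _ hF.isUnit_det, Matrix.one_mulVec]
  have h := RYM.hasDerivAt_ricciNil D hw
  simp only [← hF.ricciNil_mulVec, hFv] at h
  exact h

/-- The Ricci tensor is invariant under the geodesic flow precisely when `S = ∑ (D^k)²` commutes
with every `D^k`. -/
theorem ricciIsGeodesicFlowInvariant_iff (hF : IsFrame C B D F) :
    RicciIsGeodesicFlowInvariant C B ↔ ∀ k, sqSum D * (D k).1 = (D k).1 * sqSum D := by
  have key : (∀ k, sqSum D * (D k).1 = (D k).1 * sqSum D) ↔
      ∀ z x, (jMatrix D z *ᵥ x) ⬝ᵥ (sqSum D *ᵥ x) = 0 := by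
    constructor
    · intro h z x
      have hJ : sqSum D * jMatrix D z = jMatrix D z * sqSum D := by
        simp only [jMatrix, Finset.mul_sum, Finset.sum_mul, Matrix.mul_smul, Matrix.smul_mul, h]
      have hJt : (jMatrix D z)ᵀ = -jMatrix D z := by
        simp [jMatrix, Matrix.transpose_sum, D.transpose_eq]
      have h1 : (jMatrix D z *ᵥ x) ⬝ᵥ (sqSum D *ᵥ x) = x ⬝ᵥ ((sqSum D * jMatrix D z) *ᵥ x) := by
        rw [dotProduct_comm, ← Matrix.mulVec_mulVec, Matrix.dotProduct_mulVec x,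
          ← Matrix.mulVec_transpose, sqSum_transpose]
      have h2 : (jMatrix D z *ᵥ x) ⬝ᵥ (sqSum D *ᵥ x) = -(x ⬝ᵥ ((jMatrix D z * sqSum D) *ᵥ x)) := by
        rw [← Matrix.mulVec_mulVec, Matrix.dotProduct_mulVec x, ← Matrix.mulVec_transpose, hJt,
          Matrix.neg_mulVec, neg_dotProduct, neg_neg]
      rw [hJ] at h1
      linarith
    · intro h k
      -- polarization of the quadratic form `x ↦ ⟨D^k x, S x⟩`
      have hsym : ∀ x y, ((D k).1 *ᵥ x) ⬝ᵥ (sqSum D *ᵥ y) + ((D k).1 *ᵥ y) ⬝ᵥ (sqSum D *ᵥ x) = 0 := by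
        intro x y
        have h1 := h (Pi.single k 1) (x + y)
        have h2 := h (Pi.single k 1) x
        have h3 := h (Pi.single k 1) y
        simp only [jMatrix_single, Matrix.mulVec_add, add_dotProduct, dotProduct_add] at h1 h2 h3
        linarith
      refine Matrix.ext fun i j => ?_
      have h1 := hsym (Pi.single i 1) (Pi.single j 1)
      have h2 : ((D k).1 *ᵥ Pi.single i 1) ⬝ᵥ (sqSum D *ᵥ Pi.single j 1)
          = -((D k).1 * sqSum D) i j := by
        rw [dotProduct_comm, D.dotProduct_mulVec_swap, single_one_dotProduct, Matrix.mulVec_mulVec,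
          Matrix.mulVec_single_one, Matrix.col_apply]
      have h3 : ((D k).1 *ᵥ Pi.single j 1) ⬝ᵥ (sqSum D *ᵥ Pi.single i 1)
          = (sqSum D * (D k).1) i j := by
        conv_rhs => rw [← sqSum_transpose]
        simp [Matrix.mul_apply, dotProduct, mul_comm]
      rw [h2, h3] at h1
      linarith
  rw [key]
  constructor
  · intro h z x
    obtain ⟨γ, v, ε, hε, hv0, hgeo⟩ := exists_isGeodesicOn C B (F *ᵥ (Sum.elim x z : Nil q p))
    have h0 : (0 : ℝ) ∈ Set.Ioo (-ε) ε := ⟨by linarith, hε⟩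
    have h1 := hF.hasDerivAt_ricciNil (hgeo 0 h0).2.2
    have h2 : HasDerivAt (fun s => ricciNil C B (v s) (v s)) 0 0 := by
      refine (hasDerivAt_const (0 : ℝ) (ricciNil C B (v 0) (v 0))).congr_of_eventuallyEq ?_
      filter_upwards [Ioo_mem_nhds h0.1 h0.2] with s hs
      exact h γ v (-ε) ε hgeo s hs 0 h0
    have h3 := h1.unique h2
    rw [hv0, Matrix.mulVec_mulVec, Matrix.nonsing_inv_mul _ hF.isUnit_det, Matrix.one_mulVec] at h3
    exact neg_eq_zero.1 h3
  · intro h γ v a b hgeo t ht s hs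
    have hd : ∀ r ∈ Set.Ioo a b, HasDerivAt (fun s => ricciNil C B (v s) (v s)) 0 r := by
      intro r hr
      have h1 := hF.hasDerivAt_ricciNil (hgeo r hr).2.2
      rwa [h, neg_zero] at h1
    exact isOpen_Ioo.is_const_of_deriv_eq_zero isPreconnected_Ioo
      (f := fun s => ricciNil C B (v s) (v s))
      (fun r hr => (hd r hr).differentiableAt.differentiableWithinAt)
      (fun r hr => (hd r hr).deriv) ht hs

end IsFrame

/-- A symmetric matrix that commutes with an irreducible tuple is scalar: each of its eigenspaces
is invariant. -/
theorem ActsIrreducibly.exists_eq_smul_one {D : SkewTuple q p} (hD : ActsIrreducibly D)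
    {S : Matrix (Fin q) (Fin q) ℝ} (hS : Sᵀ = S) (h : ∀ k, S * (D k).1 = (D k).1 * S) :
    ∃ c : ℝ, S = c • 1 := by
  rcases Nat.eq_zero_or_pos q with rfl | hq
  · exact ⟨0, Subsingleton.elim _ _⟩
  have hS' : S.IsHermitian := hS
  set i₀ : Fin q := ⟨0, hq⟩
  set c := hS'.eigenvalues i₀
  set w : Fin q → ℝ := ⇑(hS'.eigenvectorBasis i₀)
  have hw : S *ᵥ w = c • w := hS'.mulVec_eigenvectorBasis i₀
  have hw0 : w ≠ 0 := by
    intro h0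
    refine hS'.eigenvectorBasis.orthonormal.ne_zero i₀ ?_
    ext j
    exact congrFun h0 j
  have hmem : ∀ x, x ∈ Module.End.eigenspace (Matrix.toLin' S) c ↔ S *ᵥ x = c • x := by
    intro x; rw [Module.End.mem_eigenspace_iff, Matrix.toLin'_apply]
  rcases hD (Module.End.eigenspace (Matrix.toLin' S) c) (fun k x hx => by
    rw [hmem] at hx ⊢
    rw [Matrix.mulVec_mulVec, h, ← Matrix.mulVec_mulVec, hx, Matrix.mulVec_smul]) with h1 | h1
  · have h2 := (hmem w).2 hw
    rw [h1] at h2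
    exact absurd ((Submodule.mem_bot ℝ).1 h2) hw0
  · refine ⟨c, Matrix.ext_of_mulVec_single fun j => ?_⟩
    have h2 : Pi.single j 1 ∈ Module.End.eigenspace (Matrix.toLin' S) c := by
      rw [h1]; exact Submodule.mem_top
    rw [(hmem _).1 h2, Matrix.smul_mulVec, Matrix.one_mulVec]

end RYM

end

theorem mainTheorem3 (p q : ℕ) (hp : 1 ≤ p) (C : RYM.SkewTuple q p)
    (hC : LinearIndependent ℝ C) :
    -- a closed orbit gives a trivial Ricci Yang–Mills soliton on the group
    (IsClosed (RYM.slOrbit C) →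
      ∃ B : Matrix (Fin q ⊕ Fin p) (Fin q ⊕ Fin p) ℝ, B.PosDef ∧
        RYM.IsTrivialRYMSoliton C B) ∧
    -- which left-invariant metrics on the group are trivial Ricci Yang–Mills solitons
    (∀ B : Matrix (Fin q ⊕ Fin p) (Fin q ⊕ Fin p) ℝ, B.PosDef →
      (∃ D : RYM.SkewTuple q p, RYM.IsStructureTuple C B D) ∧
      (∀ D : RYM.SkewTuple q p, RYM.IsStructureTuple C B D →
        (RYM.IsTrivialRYMSoliton C B ↔ RYM.IsSLMinimal D) ∧
        (RYM.ActsIrreducibly D →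
          (RYM.IsTrivialRYMSoliton C B ↔ RYM.RicciIsGeodesicFlowInvariant C B))) ∧
      (RYM.IsTrivialRYMSoliton C B → RYM.RicciIsGeodesicFlowInvariant C B)) := by
  refine ⟨RYM.exists_isTrivialRYMSoliton_of_isClosed, fun B hB => ?_⟩
  have hBt : Bᵀ = B := hB.isHermitian
  obtain ⟨D₀, F₀, hF₀⟩ := RYM.exists_isFrame C hB
  have hinv : RYM.IsTrivialRYMSoliton C B → RYM.RicciIsGeodesicFlowInvariant C B := by
    rw [hF₀.isTrivialRYMSoliton_iff, hF₀.ricciIsGeodesicFlowInvariant_iff]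
    rintro ⟨c, hc⟩ k
    rw [RYM.sqSum, hc, Matrix.smul_mul, Matrix.mul_smul, Matrix.one_mul, Matrix.mul_one]
  refine ⟨⟨D₀, (RYM.isStructureTuple_iff hBt).2 ⟨F₀, hF₀⟩⟩, fun D hD => ?_, hinv⟩
  obtain ⟨F, hF⟩ := (RYM.isStructureTuple_iff hBt).1 hD
  refine ⟨?_, fun hirr => ⟨hinv, fun h => ?_⟩⟩
  · rw [hF.isTrivialRYMSoliton_iff, RYM.isSLMinimal_iff_momentSL, RYM.momentSL_eq_zero_iff]
  · rw [hF.isTrivialRYMSoliton_iff]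
    exact hirr.exists_eq_smul_one (RYM.sqSum_transpose D)
      (hF.ricciIsGeodesicFlowInvariant_iff.1 h)
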